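/- Let $S$ be a scheme, let $G$ be a smooth affine group scheme over $S$ acting (on the left) on an $S$-scheme $Y$ such that $Y\to S$ is quasi-affine (i.e. the preimage of every affine open subscheme of $S$ is a quasi-affine scheme), let $B$ be an $S$-scheme, and let $p\colon Z\to B$ be a $G$-torsor in $S$-schemes: $G$ acts on $Z$, the morphism $p$ is $G$-invariant, flat, surjective and locally of finite presentation, and $G\times_S Z\to Z\times_B Z$, $(g,z)\mapsto (gz,z)$, is an isomorphism. (A right action is regarded as a left action via $gz:=zg^{-1}$.) Let $Z\times_S^G Y$ be the contracted product, i.e. the quotient stack $[(Z\times_S Y)/G]$ for the diagonal action $g(z,y)=(zg^{-1},gy)=(gz,gy)$. Its objects over an $S$-scheme $T$ are the $G$-torsors $P\to T$ together with a $G$-equivariant morphism $P\to Z\times_S Y$, and its morphisms are the $G$-equivariant cartesian squares of torsors compatible with the morphisms to $Z\times_S Y$. It is equipped with the morphism to $B$ induced by $Z\times_S Y\to Z\xrightarrow{p} B$. Then $Z\times_S^G Y$ is represented by a $B$-scheme $X\to B$ that is quasi-affine over $B$: there is an equivalence between $Z\times_S^G Y$ and $X$ over the category of $S$-schemes, compatible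 with the morphisms to $B$. Moreover, if $Y\to S$ is separated (resp. smooth, resp. of finite type, resp. geometrically integral), then $X\to B$ is also separated (resp. smooth, resp. of finite type, resp. geometrically integral). Here a morphism $V\to W$ is geometrically integral if $V\times_W \operatorname{Spec} K$ is an integral scheme for every field $K$ and every morphism $\operatorname{Spec} K\to W$. -/

import Mathlib

open CategoryTheory MonoidalCategory CartesianMonoidalCategory AlgebraicGeometry

universe u

namespace ContractedProducts

open scoped MonObj

/-- A morphism of schemes is quasi-affine if the preimage of every affine open is a quasi-affine
scheme (in particular quasi-compact). -/
class IsQuasiAffineHom {X Y : Scheme.{u}} (f : X ⟶ Y) : Prop where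
  isQuasiAffine_preimage : ∀ U : Y.Opens, IsAffineOpen U → (f ⁻¹ᵁ U).toScheme.IsQuasiAffine

/-- A morphism of finite type: locally of finite type and quasi-compact. -/
class IsFiniteType {X Y : Scheme.{u}} (f : X ⟶ Y) : Prop extends
  LocallyOfFiniteType f, QuasiCompact f

variable {S : Scheme.{u}}

/-- Let `G` be a group scheme over `S` acting on the `S`-scheme `P`. The morphism `p : P ⟶ T` of
`S`-schemes is a `G`-torsor if it is fppf (flat, surjective, locally of finite presentation),
`G`-invariant, and `G ×_S P ⟶ P ×_T P`, `(g, x) ↦ (g x, x)` is an isomorphism. The last two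
conditions together say that the square below is cartesian. -/
structure IsTorsor (G : Over S) [GrpObj G] {P T : Over S} [ModObj G P] (p : P ⟶ T) : Prop where
  flat : Flat p.left
  surjective : Surjective p.left
  locallyOfFinitePresentation : LocallyOfFinitePresentation p.left
  isPullback : IsPullback γ[G, P] (snd G P) p p

/-- The diagonal action of `G` on `Z ×_S Y`, `g (z, y) = (g z, g y)`. In terms of the right action
`z g := g⁻¹ z` on `Z` this is `g (z, y) = (z g⁻¹, g y)`. -/
noncomputable instance diagonalAction (G Z Y : Over S) [GrpObj G] [ModObj G Z] [ModObj G Y] :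
    ModObj G (Z ⊗ Y) where
  smul := lift (G ◁ fst Z Y ≫ γ[G, Z]) (G ◁ snd Z Y ≫ γ[G, Y])
  one_smul := by
    change η[G] ▷ (Z ⊗ Y) ≫ lift _ _ = (λ_ (Z ⊗ Y)).hom
    ext1
    · rw [Category.assoc, lift_fst, ← whisker_exchange_assoc, ModObj.one_smul_self,
        leftUnitor_naturality]
    · rw [Category.assoc, lift_snd, ← whisker_exchange_assoc, ModObj.one_smul_self,
        leftUnitor_naturality]
  mul_smul := by
    change μ[G] ▷ (Z ⊗ Y) ≫ lift _ _ = (α_ G G (Z ⊗ Y)).hom ≫ G ◁ lift _ _ ≫ lift _ _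
    ext1
    · simp only [Category.assoc, lift_fst]
      rw [← whisker_exchange_assoc, ModObj.mul_smul_self, ← whiskerLeft_comp_assoc, lift_fst]
      simp
    · simp only [Category.assoc, lift_snd]
      rw [← whisker_exchange_assoc, ModObj.mul_smul_self, ← whiskerLeft_comp_assoc, lift_snd]
      simp

/-- An object, over an `S`-scheme `base`, of the quotient stack `[W/G]`: a `G`-torsor
`π : total ⟶ base` together with a `G`-equivariant morphism `φ : total ⟶ W`.
(It is used for `G` affine over `S`, where every fppf sheaf torsor is a scheme.) -/
structure QuotientStack (G W : Over S) [GrpObj G] [ModObj G W] where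
  base : Over S
  total : Over S
  [action : ModObj G total]
  π : total ⟶ base
  isTorsor : IsTorsor G π
  φ : total ⟶ W
  equivariant : IsModHom G φ

namespace QuotientStack

variable {G W : Over S} [GrpObj G] [ModObj G W]

attribute [instance] QuotientStack.action

/-- A morphism in the quotient stack: a cartesian square of torsors with `G`-equivariant upper
arrow, compatible with the morphisms to `W`. -/
@[ext]
structure Hom (ξ ζ : QuotientStack G W) where
  base : ξ.base ⟶ ζ.base
  total : ξ.total ⟶ ζ.total
  equivariant : IsModHom G total
  isPullback : IsPullback total ξ.π ζ.π base
  comp_φ : total ≫ ζ.φ = ξ.φ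

instance : Category (QuotientStack G W) where
  Hom := Hom
  id ξ := ⟨𝟙 _, 𝟙 _, inferInstance, IsPullback.of_horiz_isIso ⟨by simp⟩, by simp⟩
  comp f g :=
    have := f.equivariant
    have := g.equivariant
    ⟨f.base ≫ g.base, f.total ≫ g.total, inferInstance,
      f.isPullback.paste_horiz g.isPullback, by rw [Category.assoc, g.comp_φ, f.comp_φ]⟩
  id_comp _ := Hom.ext (Category.id_comp _) (Category.id_comp _)
  comp_id _ := Hom.ext (Category.comp_id _) (Category.comp_id _)
  assoc _ _ _ := Hom.ext (Category.assoc _ _ _) (Category.assoc _ _ _)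

variable (G W) in
/-- The structure functor of the quotient stack, to the category of `S`-schemes. -/
def toBase : QuotientStack G W ⥤ Over S where
  obj ξ := ξ.base
  map f := Hom.base f

/-- Let `q : W ⟶ B` be a `G`-invariant morphism, inducing `[W/G] ⟶ B`. The stack `[W/G]` is
represented by the `B`-scheme `f : X ⟶ B` if there is an equivalence `F` from `[W/G]` to (the stack
of points of) `X`, over the category of `S`-schemes, under which `[W/G] ⟶ B` corresponds to `f`.
The image of an object `ξ` under `[W/G] ⟶ B` is the unique morphism `ξ.base ⟶ B` whose composite
with `ξ.π` is `ξ.φ ≫ q`. -/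
def IsRepresentedBy {B : Over S} (q : W ⟶ B) {X : Over S} (f : X ⟶ B) : Prop :=
  ∃ (F : QuotientStack G W ⥤ Over X) (α : toBase G W ≅ F ⋙ Over.forget X),
    F.IsEquivalence ∧
      ∀ ξ : QuotientStack G W, ξ.π ≫ α.hom.app ξ ≫ (F.obj ξ).hom ≫ f = ξ.φ ≫ q

end QuotientStack

/-- For a `G`-torsor `p : Z ⟶ B` and a `G`-scheme `Y`, the contracted product `Z ×_S^G Y`, i.e. the
quotient stack `[(Z ×_S Y)/G]` for the diagonal action, is represented by the `B`-scheme
`f : X ⟶ B`. Its structure map to `B` is induced by the projection `Z ×_S Y ⟶ Z ⟶ B`. -/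
def ContractedProductIsRepresentedBy (G : Over S) [GrpObj G] {Z B : Over S} [ModObj G Z]
    (p : Z ⟶ B) (Y : Over S) [ModObj G Y] {X : Over S} (f : X ⟶ B) : Prop :=
  QuotientStack.IsRepresentedBy (G := G) (W := Z ⊗ Y) (fst Z Y ≫ p) f

end ContractedProducts

/-! Write `W = Z ×_S Y`, with first projection `z : W ⟶ Z` and `q = z ≫ p`. The action groupoid `G ×
W ⇉ W` is a descent datum for `z` along the fppf morphism `p`, because `Z ×_B Z ≅ G × Z`. It remains
to see that it is effective, that is, `W = Z ×_B X` for some quasi-affine `X ⟶ B`.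

Since `G` is affine, so is `p` (affineness is fppf local on the target). Let `H` be the relative
spectrum over `B` of the functions on `W` on which action and projection agree. Quasi-coherent
algebras descend: `bijective_productMap_equalizer` shows that the pullback of this algebra along `p`
is the algebra of all functions on `W` over `Z`. So `Z ×_B H` is the affine hull of `W` over `Z`,
and `W ⟶ Z ×_B H` is an open immersion because `z` is quasi-affine. Its image is stable under the
descent datum, hence is the preimage of an open `X` of `H` (`exists_isPullback_isQuasiAffineHom`).

Then `W ⟶ X` is a base change of `p` and a `G`-torsor, so `[W/G]` is `X`: equivariant morphisms of
torsors are cartesian and invariant morphisms descend (`isRepresentedBy_of_isTorsor`). Properties of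
`Y ⟶ S` pass to `z` by base change and descend along `p` to `X ⟶ B`; separatedness already follows
from quasi-affineness. -/

namespace ContractedProducts

open Limits Scheme AffineZariskiSite TensorProduct

/-! ### Equalizers of ring maps: localization and flat descent -/

section Algebra

/-- Localization of rings commutes with equalizers. -/
lemma isLocalization_away_eqLocus {M N M' N' : Type*} [CommRing M] [CommRing N]
    [CommRing M'] [CommRing N'] (a s : M →+* N) (a' s' : M' →+* N') (φ : M →+* M') (ψ : N →+* N')
    (ha : a'.comp φ = ψ.comp a) (hs : s'.comp φ = ψ.comp s) (r : M) (hr : a r = s r)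
    (hφ : letI := φ.toAlgebra; IsLocalization.Away r M')
    (hψ : letI := ψ.toAlgebra; IsLocalization.Away (s r) N')
    (χ : a.eqLocus s →+* a'.eqLocus s') (hχ : ∀ x, (χ x : M') = φ x) :
    letI := χ.toAlgebra
    IsLocalization.Away (⟨r, hr⟩ : a.eqLocus s) (a'.eqLocus s') := by
  let := φ.toAlgebra
  let := ψ.toAlgebra
  let := χ.toAlgebra
  have hχ' (x) : (algebraMap (a.eqLocus s) (a'.eqLocus s') x : M') = algebraMap M M' x := hχ x
  have ha' (x) : a' (algebraMap M M' x) = algebraMap N N' (a x) := congr($ha x)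
  have hs' (x) : s' (algebraMap M M' x) = algebraMap N N' (s x) := congr($hs x)
  refine ⟨⟨?_, ?_, ?_⟩⟩
  · rintro ⟨_, n, rfl⟩
    rw [map_pow]
    apply IsUnit.pow
    obtain ⟨u, hu⟩ := IsLocalization.Away.algebraMap_isUnit (S := M') r
    have h1 : a' ↑u = s' ↑u := by rw [hu, ha', hs', hr]
    have h2 : a' ↑u⁻¹ = s' ↑u⁻¹ := by
      have e1 : a' ↑u * a' ↑u⁻¹ = 1 := by rw [← map_mul, Units.mul_inv, map_one]
      have e2 : s' ↑u * s' ↑u⁻¹ = 1 := by rw [← map_mul, Units.mul_inv, map_one]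
      rw [← h1] at e2
      calc a' ↑u⁻¹ = a' ↑u⁻¹ * (a' ↑u * s' ↑u⁻¹) := by rw [e2, mul_one]
        _ = (a' ↑u * a' ↑u⁻¹) * s' ↑u⁻¹ := by ring
        _ = _ := by rw [e1, one_mul]
    refine IsUnit.of_mul_eq_one ⟨↑u⁻¹, h2⟩ (Subtype.ext ?_)
    change (algebraMap (a.eqLocus s) (a'.eqLocus s') ⟨r, hr⟩ : M') * ↑u⁻¹ = 1
    rw [hχ', ← hu, Units.mul_inv]
  · rintro ⟨x, hx⟩
    obtain ⟨n, m, hm⟩ := IsLocalization.Away.surj r x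
    have hx' : a' x = s' x := hx
    have h1 : algebraMap N N' (a m) = algebraMap N N' (s m) := by
      rw [← ha', ← hs', ← hm, map_mul, map_mul, map_pow, map_pow, hx', ha', hs', hr]
    -- The numerator `m` is equalized only after localizing; a further power of `r` moves it into
    -- the equalizer.
    obtain ⟨k, hk⟩ := IsLocalization.Away.exists_of_eq (s r) h1
    refine ⟨⟨⟨r ^ k * m, ?_⟩, ⟨⟨r, hr⟩ ^ (n + k), ⟨_, rfl⟩⟩⟩, Subtype.ext ?_⟩
    · change a _ = s _
      rw [map_mul, map_mul, map_pow, map_pow, hr, hk]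
    · change x * (algebraMap (a.eqLocus s) (a'.eqLocus s') (⟨r, hr⟩ ^ (n + k)) : M') = _
      rw [hχ', hχ', SubmonoidClass.coe_pow]
      simp only [map_pow, map_mul, ← hm]
      ring
  · intro x y h
    have h' : algebraMap M M' x = algebraMap M M' y := by rw [← hχ', ← hχ', h]
    obtain ⟨k, hk⟩ := IsLocalization.Away.exists_of_eq r h'
    exact ⟨⟨⟨r, hr⟩ ^ k, _, rfl⟩, Subtype.ext (by simpa using hk)⟩

/-- Faithfully flat descent for algebras, in the form in which it applies to a torsor: if `a` and
`s` are the two coface maps of a descent datum, and `t` and `s` identify `N` with `R' ⊗ M`,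
then `M` is the base change of the equalizer of `a` and `s`. -/
lemma bijective_productMap_equalizer {R R' M N L : Type*} [CommRing R] [CommRing R'] [CommRing M]
    [CommRing N] [CommRing L] [Algebra R R'] [Algebra R M] [Algebra R N] [Algebra R L]
    [Module.Flat R R'] (a s : M →ₐ[R] N) (z : R' →ₐ[R] M) (e : N →ₐ[R] M) (u v d : N →ₐ[R] L)
    (hN : Function.Bijective (Algebra.TensorProduct.productMap (a.comp z) s))
    (hL : Function.Injective (Algebra.TensorProduct.productMap (v.comp (a.comp z)) u))
    (ha : e.comp a = .id R M) (hva : v.comp a = d.comp a) (hvs : v.comp s = u.comp a)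
    (hds : d.comp s = u.comp s) :
    Function.Bijective (Algebra.TensorProduct.productMap z (AlgHom.equalizer a s).val) := by
  set P := Algebra.TensorProduct.productMap z (AlgHom.equalizer a s).val
  have ha' (m) : e (a m) = m := congr($ha m)
  -- Under `R' ⊗ M ≅ N`, the map `a ∘ P` is the inclusion of the equalizer tensored with `R'`, so it
  -- is injective by flatness.
  have key : a.comp P = (Algebra.TensorProduct.productMap (a.comp z) s).comp
      (Algebra.TensorProduct.map (AlgHom.id R R') (AlgHom.equalizer a s).val) := by
    ext x
    · simp [P]
    · simpa [P, -SetLike.coe_mem] using (AlgHom.mem_equalizer a s _).mp x.2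
  have hflat : Function.Injective
      (Algebra.TensorProduct.map (AlgHom.id R R') (AlgHom.equalizer a s).val) :=
    Module.Flat.lTensor_preserves_injective_linearMap (AlgHom.equalizer a s).val.toLinearMap
      Subtype.val_injective
  refine ⟨.of_comp (f := a) ?_, fun m ↦ ?_⟩
  · have : a ∘ P = a.comp P := rfl
    rw [this, key]
    exact hN.1.comp hflat
  -- The element `y` of `R' ⊗ M` corresponding to `a m` is equalized by `1 ⊗ a` and `1 ⊗ s`: in `L`
  -- this is the cocycle identity `v (a m) = d (a m)`. As `R'` is flat, `y` comes from `R'` tensored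
  -- with the equalizer, and the retraction `e` of `a` then recovers `m`.
  · obtain ⟨y, hy⟩ := hN.2 (a m)
    have h1 : (Algebra.TensorProduct.productMap (v.comp (a.comp z)) u).comp
        (Algebra.TensorProduct.map (AlgHom.id R R') a) =
        v.comp (Algebra.TensorProduct.productMap (a.comp z) s) := by
      ext x
      · simp
      · simpa using congr($hvs.symm x)
    have h2 : (Algebra.TensorProduct.productMap (v.comp (a.comp z)) u).comp
        (Algebra.TensorProduct.map (AlgHom.id R R') s) =
        d.comp (Algebra.TensorProduct.productMap (a.comp z) s) := by
      ext x
      · simpa using congr($hva (z x))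
      · simpa using congr($hds.symm x)
    have h3 : Algebra.TensorProduct.map (AlgHom.id R R') a y =
        Algebra.TensorProduct.map (AlgHom.id R R') s y := by
      apply hL
      refine congr($h1 y).trans (.trans ?_ congr($h2 y).symm)
      change v (Algebra.TensorProduct.productMap (a.comp z) s y) =
        d (Algebra.TensorProduct.productMap (a.comp z) s y)
      rw [hy]
      exact congr($hva m)
    refine ⟨(AlgHom.tensorEqualizerEquiv R R' a s).symm ⟨y, h3⟩, ?_⟩
    set x := (AlgHom.tensorEqualizerEquiv R R' a s).symm ⟨y, h3⟩ with hx
    have h4 : Algebra.TensorProduct.map (AlgHom.id R R') (AlgHom.equalizer a s).val x = y := by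
      rw [← AlgHom.coe_tensorEqualizer R R' a s, ← AlgHom.tensorEqualizerEquiv_apply, hx,
        AlgEquiv.apply_symm_apply]
    rw [← ha' (P x), ← ha' m, ← hy, ← h4]
    exact congr(e ($key x))

end Algebra

/-! ### The presheaf of algebras of invariants on `B` -/

section AffineHull

lemma isLocalization_away_of_eq_basicOpen {X : Scheme.{u}} {U V : X.Opens}
    (hU : IsCompact (U : Set X)) (hU' : IsQuasiSeparated (U : Set X)) (f : Γ(X, U)) (i : V ≤ U)
    (hV : V = X.basicOpen f) :
    letI := (X.presheaf.map (homOfLE i).op).hom.toAlgebra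
    IsLocalization.Away f Γ(X, V) := by
  subst hV
  exact isLocalization_basicOpen_of_qcqs hU hU' f

variable {E W B : Scheme.{u}} (a s : E ⟶ W) (q : W ⟶ B) (h : a ≫ q = s ≫ q)

include h in
lemma preimage_le_of_comp_eq (V : B.Opens) : s ⁻¹ᵁ q ⁻¹ᵁ V ≤ a ⁻¹ᵁ q ⁻¹ᵁ V := by
  rw [← Scheme.Hom.comp_preimage, ← Scheme.Hom.comp_preimage, h]

/-- The ring of functions on `q ⁻¹ V` that are equalized by `a` and `s`. -/
def invariants (V : B.Opens) : Subring Γ(W, q ⁻¹ᵁ V) :=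
  (a.appLE (q ⁻¹ᵁ V) (s ⁻¹ᵁ q ⁻¹ᵁ V) (preimage_le_of_comp_eq a s q h V)).hom.eqLocus
    (s.app (q ⁻¹ᵁ V)).hom

lemma mem_invariants {V : B.Opens} (x : Γ(W, q ⁻¹ᵁ V)) :
    x ∈ invariants a s q h V ↔
      a.appLE (q ⁻¹ᵁ V) (s ⁻¹ᵁ q ⁻¹ᵁ V) (preimage_le_of_comp_eq a s q h V) x =
        s.app (q ⁻¹ᵁ V) x := Iff.rfl

lemma map_mem_invariants {U V : B.Opens} (i : U ≤ V) {x : Γ(W, q ⁻¹ᵁ V)}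
    (hx : x ∈ invariants a s q h V) :
    W.presheaf.map (homOfLE (q.preimage_mono i)).op x ∈ invariants a s q h U := by
  rw [mem_invariants] at hx ⊢
  have h1 : W.presheaf.map (homOfLE (q.preimage_mono i)).op ≫
      a.appLE (q ⁻¹ᵁ U) (s ⁻¹ᵁ q ⁻¹ᵁ U) (preimage_le_of_comp_eq a s q h U) =
      a.appLE (q ⁻¹ᵁ V) (s ⁻¹ᵁ q ⁻¹ᵁ V) (preimage_le_of_comp_eq a s q h V) ≫
      E.presheaf.map (homOfLE (s.preimage_mono (q.preimage_mono i))).op := by simp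
  have h2 : W.presheaf.map (homOfLE (q.preimage_mono i)).op ≫ s.app (q ⁻¹ᵁ U) =
      s.app (q ⁻¹ᵁ V) ≫ E.presheaf.map (homOfLE (s.preimage_mono (q.preimage_mono i))).op := by
    simp [Scheme.Hom.app_eq_appLE]
  exact congr($h1 x).trans (.trans congr(E.presheaf.map _ $hx) congr($h2 x).symm)

lemma app_mem_invariants (V : B.Opens) (x : Γ(B, V)) : q.app V x ∈ invariants a s q h V := by
  rw [mem_invariants]
  have h1 : q.app V ≫ a.appLE (q ⁻¹ᵁ V) (s ⁻¹ᵁ q ⁻¹ᵁ V) (preimage_le_of_comp_eq a s q h V) =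
      q.app V ≫ s.app (q ⁻¹ᵁ V) := by
    simp only [Scheme.Hom.app_eq_appLE, Scheme.Hom.appLE_comp_appLE]
    congr 1
  exact congr($h1 x)

/-- The presheaf on `B` of the functions on `W` that are equalized by `a` and `s`. -/
def invariantsPresheaf : B.Opensᵒᵖ ⥤ CommRingCat where
  obj V := .of (invariants a s q h V.unop)
  map {V U} i := CommRingCat.ofHom <|
    (W.presheaf.map (homOfLE (q.preimage_mono i.unop.le)).op).hom.restrict _ _
      fun _ hx ↦ map_mem_invariants a s q h i.unop.le hx
  map_id U := by simp; rfl
  map_comp i j := by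
    simp only [← CommRingCat.ofHom_comp]
    rw [← homOfLE_comp (q.preimage_mono j.unop.le) (q.preimage_mono i.unop.le), op_comp]
    simp_rw [W.presheaf.map_comp]
    rfl

/-- The map from the structure sheaf of `B`. -/
def invariantsPresheafMap : B.presheaf ⟶ invariantsPresheaf a s q h where
  app V := CommRingCat.ofHom ((q.app V.unop).hom.codRestrict _ (app_mem_invariants a s q h V.unop))
  naturality {U V} i := by ext x; exact Subtype.ext congr($(q.naturality i) x)

/-- This is quasi-coherence of the invariants, which the relative spectrum needs. Functions on
preimages under the qcqs morphisms `q` and `s ≫ q` localize on basic opens, and localization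
commutes with equalizers. -/
lemma coequifibered_invariantsPresheafMap [QuasiCompact q] [QuasiSeparated q]
    [QuasiCompact (s ≫ q)] [QuasiSeparated (s ≫ q)] :
    ((toOpensFunctor B).op.whiskerLeft (invariantsPresheafMap a s q h)).Coequifibered := by
  refine coequifibered_iff_forall_isLocalizationAway.mpr fun U r ↦ ?_
  refine isLocalization_away_eqLocus
    (a.appLE (q ⁻¹ᵁ U.1) (s ⁻¹ᵁ q ⁻¹ᵁ U.1) (preimage_le_of_comp_eq a s q h U.1)).hom
    (s.app (q ⁻¹ᵁ U.1)).hom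
    (a.appLE (q ⁻¹ᵁ B.basicOpen r) (s ⁻¹ᵁ q ⁻¹ᵁ B.basicOpen r)
      (preimage_le_of_comp_eq a s q h (B.basicOpen r))).hom
    (s.app (q ⁻¹ᵁ B.basicOpen r)).hom
    (W.presheaf.map (homOfLE (q.preimage_mono (B.basicOpen_le r))).op).hom
    (E.presheaf.map (homOfLE (s.preimage_mono (q.preimage_mono (B.basicOpen_le r)))).op).hom
    ?_ ?_ (q.app U.1 r) (app_mem_invariants a s q h _ _) ?_ ?_
    ((invariantsPresheaf a s q h).map (homOfLE (B.basicOpen_le r)).op).hom fun x ↦ rfl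
  · simp only [← CommRingCat.hom_comp]
    congr 1
    simp
  · simp only [← CommRingCat.hom_comp]
    congr 1
    simp [Scheme.Hom.app_eq_appLE]
  · exact isLocalization_away_of_eq_basicOpen (q.isCompact_preimage U.2.isCompact)
      (q.isQuasiSeparated_preimage U.2.isQuasiSeparated) _ _ (q.preimage_basicOpen r)
  · exact isLocalization_away_of_eq_basicOpen ((s ≫ q).isCompact_preimage U.2.isCompact)
      ((s ≫ q).isQuasiSeparated_preimage U.2.isQuasiSeparated) _ _
      ((congrArg (s ⁻¹ᵁ ·) (q.preimage_basicOpen r)).trans (s.preimage_basicOpen _))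

end AffineHull

/-! ### The relative spectrum of the invariants and the morphism from `W` -/

section AffineHull

lemma pullbackRestrictIsoRestrict_inv_map_hom {W B : Scheme.{u}} (q : W ⟶ B) {U V : B.Opens}
    (i : U ≤ V) :
    (pullbackRestrictIsoRestrict q U).inv ≫
      pullback.map q U.ι q V.ι (𝟙 W) (B.homOfLE i) (𝟙 B) (by simp) (by simp) ≫
      (pullbackRestrictIsoRestrict q V).hom = W.homOfLE (q.preimage_mono i) := by
  rw [← cancel_mono (Scheme.Opens.ι _)]
  simp only [Category.assoc, pullbackRestrictIsoRestrict_hom_ι, Scheme.homOfLE_ι]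
  rw [pullback.lift_fst, Category.comp_id, pullbackRestrictIsoRestrict_inv_fst]

variable {E W B : Scheme.{u}} (a s : E ⟶ W) (q : W ⟶ B) (h : a ≫ q = s ≫ q)
  [QuasiCompact q] [QuasiSeparated q] [QuasiCompact (s ≫ q)] [QuasiSeparated (s ≫ q)]

/-- The diagram of affine schemes that we glue to form the affine hull. -/
noncomputable def affineHullGlueData : (directedCover B).RelativeGluingData :=
  relativeGluingData (coequifibered_invariantsPresheafMap a s q h)

instance : ((affineHullGlueData a s q h).functor ⋙ Scheme.forget).IsLocallyDirected :=
  Cover.RelativeGluingData.instIsLocallyDirectedI₀CompFunctorForgetOfIsThin ..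

/-- The relative spectrum over `B` of the algebra of functions on `W` that are equalized by `a`
and `s`. -/
noncomputable def affineHull : Scheme.{u} := (affineHullGlueData a s q h).glued

/-- The structure morphism of the affine hull. -/
noncomputable def fromAffineHull : affineHull a s q h ⟶ B :=
  (affineHullGlueData a s q h).toBase

/-- The spectrum of a ring of invariants is an open subscheme of the affine hull. -/
noncomputable def affineHullι (U : B.affineOpens) :
    Spec ((invariantsPresheaf a s q h).obj (.op U.1)) ⟶ affineHull a s q h :=
  (affineHullGlueData a s q h).cover.f U

instance (U : B.affineOpens) : IsOpenImmersion (affineHullι a s q h U) :=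
  (affineHullGlueData a s q h).cover.map_prop U

lemma affineHullι_w {U V : B.affineOpens} (i : (show B.AffineZariskiSite from U) ⟶ V) :
    Spec.map ((invariantsPresheaf a s q h).map (homOfLE (toOpens_mono i.1.1)).op) ≫
      affineHullι a s q h V = affineHullι a s q h U :=
  colimit.w (affineHullGlueData a s q h).functor i

lemma affineHullι_fromAffineHull (U : B.affineOpens) :
    affineHullι a s q h U ≫ fromAffineHull a s q h =
      Spec.map ((invariantsPresheafMap a s q h).app (.op U.1)) ≫ U.2.fromSpec :=
  colimit.ι_desc _ _

lemma fromAffineHull_preimage (U : B.affineOpens) :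
    fromAffineHull a s q h ⁻¹ᵁ U = (affineHullι a s q h U).opensRange :=
  (congrArg (fromAffineHull a s q h ⁻¹ᵁ ·) (Scheme.Opens.opensRange_ι U.1).symm).trans
    ((affineHullGlueData a s q h).toBase_preimage_eq_opensRange_ι U)

/-- The inclusion of the ring of invariants. -/
def invariantsVal (V : B.Opens) : (invariantsPresheaf a s q h).obj (.op V) ⟶ Γ(W, q ⁻¹ᵁ V) :=
  CommRingCat.ofHom (invariants a s q h V).subtype

/-- The restriction of the morphism into the affine hull to the preimage of an affine open. -/
noncomputable def toAffineHullAux (U : (directedCover B).I₀) :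
    pullback q (Scheme.Opens.ι U.1) ⟶ affineHull a s q h :=
  (pullbackRestrictIsoRestrict q U.1).hom ≫ (q ⁻¹ᵁ U.1).toSpecΓ ≫
    Spec.map (invariantsVal a s q h U.1) ≫ affineHullι a s q h U

lemma trans_toAffineHullAux {U V : ((directedCover B).pullback₁ q).I₀} (i : U ⟶ V) :
    Cover.trans ((directedCover B).pullback₁ q) i ≫ toAffineHullAux a s q h V =
      toAffineHullAux a s q h U := by
  change pullback.map q (Scheme.Opens.ι U.1) q (Scheme.Opens.ι V.1) (𝟙 W)
    (B.homOfLE (toOpens_mono i.1.1)) (𝟙 B) (by simp) (by simp) ≫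
    (pullbackRestrictIsoRestrict q V.1).hom ≫
      (q ⁻¹ᵁ V.1).toSpecΓ ≫ Spec.map (invariantsVal a s q h V.1) ≫ affineHullι a s q h V =
      (pullbackRestrictIsoRestrict q U.1).hom ≫
      (q ⁻¹ᵁ U.1).toSpecΓ ≫ Spec.map (invariantsVal a s q h U.1) ≫ affineHullι a s q h U
  rw [← Iso.inv_comp_eq, reassoc_of% pullbackRestrictIsoRestrict_inv_map_hom,
    ← Scheme.Opens.toSpecΓ_SpecMap_presheaf_map_assoc, ← Spec.map_comp_assoc,
    ← affineHullι_w a s q h i, ← Spec.map_comp_assoc]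
  rfl

/-- The morphism into the affine hull. -/
noncomputable def toAffineHull : W ⟶ affineHull a s q h :=
  Scheme.OpenCover.glueMorphismsOfLocallyDirected ((directedCover B).pullback₁ q)
    (toAffineHullAux a s q h) (trans_toAffineHullAux a s q h)

lemma ι_toAffineHull (U : B.affineOpens) :
    (q ⁻¹ᵁ U.1).ι ≫ toAffineHull a s q h = (q ⁻¹ᵁ U.1).toSpecΓ ≫
      Spec.map (invariantsVal a s q h U.1) ≫ affineHullι a s q h U := by
  rw [← cancel_epi (pullbackRestrictIsoRestrict q U.1).hom, ← Category.assoc,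
    pullbackRestrictIsoRestrict_hom_ι]
  exact Scheme.OpenCover.map_glueMorphismsOfLocallyDirected ((directedCover B).pullback₁ q)
    (toAffineHullAux a s q h) (trans_toAffineHullAux a s q h) U

@[simp]
lemma toAffineHull_fromAffineHull : toAffineHull a s q h ≫ fromAffineHull a s q h = q := by
  refine Scheme.Cover.hom_ext (W.openCoverOfIsOpenCover _
    (.comap (iSup_affineOpens_eq_top B) q.base.1)) _ _ fun (U : B.affineOpens) ↦ ?_
  refine ((reassoc_of% (ι_toAffineHull a s q h U)) _).trans ?_
  rw [affineHullι_fromAffineHull, ← Spec.map_comp_assoc]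
  change (q ⁻¹ᵁ U.1).toSpecΓ ≫ Spec.map (q.app _) ≫ U.2.fromSpec = (q ⁻¹ᵁ U.1).ι ≫ _
  simp [U.2.toSpecΓ_fromSpec]

instance : IsAffineHom (fromAffineHull a s q h) := by
  refine isAffineHom_of_forall_exists_isAffineOpen _ fun x ↦ ?_
  obtain ⟨_, ⟨U, hU, rfl⟩, hxU, -⟩ :=
    B.isBasis_affineOpens.exists_subset_of_mem_open (Set.mem_univ x) isOpen_univ
  refine ⟨U, hxU, hU, ?_⟩
  rw [fromAffineHull_preimage a s q h ⟨U, hU⟩]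
  exact isAffineOpen_opensRange _

/-- The sections of the affine hull on the preimage of an affine open are the invariants. -/
noncomputable def affineHullObjIso {U : B.Opens} (hU : IsAffineOpen U) :
    Γ(affineHull a s q h, fromAffineHull a s q h ⁻¹ᵁ U) ≅
      (invariantsPresheaf a s q h).obj (.op U) :=
  (affineHull a s q h).presheaf.mapIso (eqToIso
    (by simpa using! (fromAffineHull_preimage a s q h ⟨U, hU⟩).symm)).op ≪≫
  (affineHullι a s q h ⟨U, hU⟩).appIso ⊤ ≪≫ Scheme.ΓSpecIso _

lemma affineHullObjIso_hom {U : B.Opens} (hU : IsAffineOpen U) :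
    (affineHullObjIso a s q h hU).hom =
      (affineHullι a s q h ⟨U, hU⟩).appLE (fromAffineHull a s q h ⁻¹ᵁ U) ⊤
        (by rw [fromAffineHull_preimage a s q h ⟨U, hU⟩]; simp) ≫ (Scheme.ΓSpecIso _).hom := by
  simp only [affineHullObjIso, Iso.trans_hom, ← Category.assoc]
  congr 1
  simp only [Functor.mapIso_hom, Iso.op_hom, eqToIso.hom, Scheme.Hom.appIso_hom']
  exact Scheme.Hom.map_appLE _ _ _

/-- This turns statements about the inclusion of invariants into statements about the morphism from
`W` to the hull. -/
lemma affineHullObjIso_hom_val {U : B.Opens} (hU : IsAffineOpen U) :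
    (affineHullObjIso a s q h hU).hom ≫ invariantsVal a s q h U =
    (toAffineHull a s q h).appLE (fromAffineHull a s q h ⁻¹ᵁ U) (q ⁻¹ᵁ U)
      (by simp [← Scheme.Hom.comp_preimage]) := by
  have e1 : (⊤ : (q ⁻¹ᵁ U).toScheme.Opens) ≤
      ((q ⁻¹ᵁ U).ι ≫ toAffineHull a s q h) ⁻¹ᵁ fromAffineHull a s q h ⁻¹ᵁ U := by
    simp [← Scheme.Hom.comp_preimage]
  have h1 : ((q ⁻¹ᵁ U).ι ≫ toAffineHull a s q h).appLE (fromAffineHull a s q h ⁻¹ᵁ U) ⊤ e1 =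
      ((q ⁻¹ᵁ U).toSpecΓ ≫ Spec.map (invariantsVal a s q h U) ≫
        affineHullι a s q h ⟨U, hU⟩).appLE (fromAffineHull a s q h ⁻¹ᵁ U) ⊤
        (ι_toAffineHull a s q h ⟨U, hU⟩ ▸ e1) := by
    simp only [← ι_toAffineHull a s q h ⟨U, hU⟩]
  have e2 : (⊤ : (Spec ((invariantsPresheaf a s q h).obj (.op U))).Opens) ≤
      affineHullι a s q h ⟨U, hU⟩ ⁻¹ᵁ fromAffineHull a s q h ⁻¹ᵁ U := by
    rw [fromAffineHull_preimage a s q h ⟨U, hU⟩]; simp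
  rw [← Scheme.Hom.appLE_comp_appLE _ _ _ (q ⁻¹ᵁ U) _
    (by simp [← Scheme.Hom.comp_preimage]) (by simp),
    ← Scheme.Hom.appLE_comp_appLE _ _ _ ⊤ _ (by exact fun _ _ ↦ e2 trivial) (by simp),
    ← Scheme.Hom.appLE_comp_appLE _ _ _ ⊤ _ e2 (by simp)] at h1
  rw [affineHullObjIso_hom, ← cancel_mono ((q ⁻¹ᵁ U).ι.appLE (q ⁻¹ᵁ U) ⊤ (by simp)), h1]
  simp only [Category.assoc]
  congr 1
  rw [Scheme.Opens.ι_appLE]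
  have h2 : (Spec.map (invariantsVal a s q h U)).appLE ⊤ ⊤ (by simp) =
      (Spec.map (invariantsVal a s q h U)).appTop := (Scheme.Hom.app_eq_appLE _).symm
  have h3 : (q ⁻¹ᵁ U).toSpecΓ.appLE ⊤ ⊤ (by simp) = (q ⁻¹ᵁ U).toSpecΓ.appTop :=
    (Scheme.Hom.app_eq_appLE _).symm
  rw [h2, h3, Scheme.Opens.toSpecΓ_appTop, Scheme.ΓSpecIso_naturality_assoc]
  simp
  rfl

/-- Over an affine open of `B` the morphism is given by the inclusion of invariants, on which `a`
and `s` agree by definition. -/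
lemma comp_toAffineHull : a ≫ toAffineHull a s q h = s ≫ toAffineHull a s q h := by
  refine Scheme.Cover.hom_ext (E.openCoverOfIsOpenCover _
    (.comap (iSup_affineOpens_eq_top B) (s ≫ q).base.1)) _ _ fun (U : B.affineOpens) ↦ ?_
  have ha : (s ⁻¹ᵁ q ⁻¹ᵁ U.1).ι ≫ a = a.resLE _ _ (preimage_le_of_comp_eq a s q h U.1) ≫
    (q ⁻¹ᵁ U.1).ι := by simp
  have hs : (s ⁻¹ᵁ q ⁻¹ᵁ U.1).ι ≫ s = s.resLE _ _ le_rfl ≫ (q ⁻¹ᵁ U.1).ι := by simp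
  change (s ⁻¹ᵁ q ⁻¹ᵁ U.1).ι ≫ a ≫ _ = (s ⁻¹ᵁ q ⁻¹ᵁ U.1).ι ≫ s ≫ _
  rw [reassoc_of% ha, reassoc_of% hs, ι_toAffineHull,
    ← Scheme.Opens.toSpecΓ_SpecMap_appLE_assoc, ← Scheme.Opens.toSpecΓ_SpecMap_appLE_assoc,
    ← Spec.map_comp_assoc, ← Spec.map_comp_assoc]
  congr 3
  ext x
  exact (x.2 : _ = s.app _ _).trans congr($(s.app_eq_appLE) x.1)

end AffineHull

/-! ### Flat base change of global sections and fppf descent of affineness -/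

section Descent

lemma isPullback_SpecMap_appTop_of_flat {T V Y Y' : Scheme.{u}} {φ : T ⟶ V} {g : Y ⟶ V}
    {fst : Y' ⟶ T} {snd : Y' ⟶ Y} (h : IsPullback fst snd φ g) [IsAffine T] [IsAffine V] [Flat φ]
    [CompactSpace Y] [QuasiSeparatedSpace Y] :
    IsPullback (Spec.map fst.appTop) (Spec.map snd.appTop) (Spec.map φ.appTop)
      (Spec.map g.appTop) := by
  have h1 := (isIso_pushoutSection_iff h.flip (US := ⊤) (UT := ⊤) (UX := ⊤) (UY := ⊤)
    (by simp) (by simp) (by simp)).mp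
    (isIso_pushoutSection_of_isQuasiSeparated_of_flat_right _ _ _ _ (isAffineOpen_top _)
      (isAffineOpen_top _) isCompact_univ isQuasiSeparated_univ)
  simpa only [Scheme.Hom.appTop, Scheme.Hom.app_eq_appLE] using!
    (isPullback_SpecMap_of_isPushout _ _ _ _ h1).flip

/-- The formation of the affine hull of a qcqs scheme commutes with flat base change. -/
lemma isPullback_toSpecΓ_of_flat {T V Y Y' : Scheme.{u}} {φ : T ⟶ V} {g : Y ⟶ V} {fst : Y' ⟶ T}
    {snd : Y' ⟶ Y} (h : IsPullback fst snd φ g) [IsAffine T] [IsAffine V] [Flat φ]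
    [CompactSpace Y] [QuasiSeparatedSpace Y] :
    IsPullback snd Y'.toSpecΓ Y.toSpecΓ (Spec.map snd.appTop) := by
  refine IsPullback.of_bot ?_ (Scheme.toSpecΓ_naturality snd)
    (isPullback_SpecMap_appTop_of_flat h).flip
  have h3 : IsPullback φ T.toSpecΓ V.toSpecΓ (Spec.map φ.appTop) :=
    .of_vert_isIso ⟨Scheme.toSpecΓ_naturality φ⟩
  have h4 := h.flip.paste_vert h3
  rwa [Scheme.toSpecΓ_naturality, Scheme.toSpecΓ_naturality] at h4

/-- `Y'.toSpecΓ` is the base change of `Y.toSpecΓ` along a faithfully flat quasi-compact morphism,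
and being an isomorphism descends. That comparison needs `Y` qcqs, which is inherited from the
affine `Y'` through the surjection `snd`. -/
lemma isAffine_of_isPullback {T V Y Y' : Scheme.{u}} {φ : T ⟶ V} {g : Y ⟶ V} {fst : Y' ⟶ T}
    {snd : Y' ⟶ Y} (h : IsPullback fst snd φ g) [IsAffine T] [IsAffine V] [Flat φ]
    [Surjective φ] [IsAffine Y'] : IsAffine Y := by
  have hs : IsAffineHom snd := MorphismProperty.of_isPullback h (inferInstance : IsAffineHom φ)
  have hs' : Surjective snd := MorphismProperty.of_isPullback h (inferInstance : Surjective φ)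
  have hs'' : Flat snd := MorphismProperty.of_isPullback h (inferInstance : Flat φ)
  have : CompactSpace Y := snd.surjective.compactSpace snd.continuous
  have : QuasiSeparatedSpace Y := by
    rw [quasiSeparatedSpace_iff_forall_affineOpens]
    intro U V
    have h1 : IsAffineOpen (snd ⁻¹ᵁ (U.1 ⊓ V.1)) := (U.2.preimage snd).inf (V.2.preimage snd)
    have h2 := h1.isCompact.image snd.continuous
    have h3 : snd '' (snd ⁻¹' ((U.1 ⊓ V.1 : Y.Opens) : Set Y)) = (U.1 ⊓ V.1 : Y.Opens) :=
      Set.image_preimage_eq _ snd.surjective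
    change IsCompact ((U.1 ⊓ V.1 : Y.Opens) : Set Y)
    rw [← h3]
    exact h2
  have h1 := isPullback_toSpecΓ_of_flat h
  have hiso := MorphismProperty.of_isPullback_of_descendsAlong
    (P := MorphismProperty.isomorphisms Scheme.{u}) (Q := @Surjective ⊓ @Flat ⊓ @QuasiCompact)
    h1.flip ?_ (inferInstance : IsIso Y'.toSpecΓ)
  · exact ⟨hiso⟩
  · have h2 : Spec.map φ.appTop = inv T.toSpecΓ ≫ φ ≫ V.toSpecΓ := by
      rw [Scheme.toSpecΓ_naturality, IsIso.inv_hom_id_assoc]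
    have h3 : Surjective (Spec.map φ.appTop) := h2 ▸ inferInstance
    have h4 : Flat (Spec.map φ.appTop) := h2 ▸ inferInstance
    have h5 := isPullback_SpecMap_appTop_of_flat h
    exact ⟨⟨MorphismProperty.of_isPullback h5 h3, MorphismProperty.of_isPullback h5 h4⟩,
      inferInstance⟩

/-- Being affine descends along flat surjective morphisms locally of finite presentation. -/
lemma isAffineHom_of_isPullback {A X Y Z : Scheme.{u}} {fst : A ⟶ X} {snd : A ⟶ Y} {f : X ⟶ Z}
    {g : Y ⟶ Z} (h : IsPullback fst snd f g) [Flat f] [Surjective f]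
    [LocallyOfFinitePresentation f] [IsAffineHom fst] : IsAffineHom g := by
  refine isAffineHom_of_forall_exists_isAffineOpen _ fun z ↦ ?_
  obtain ⟨x, rfl⟩ := f.surjective z
  obtain ⟨_, ⟨V, hV, rfl⟩, hxV, -⟩ :=
    Z.isBasis_affineOpens.exists_subset_of_mem_open (Set.mem_univ (f x)) isOpen_univ
  obtain ⟨_, ⟨U, hU, rfl⟩, hxU, hUV⟩ :=
    X.isBasis_affineOpens.exists_subset_of_mem_open (show x ∈ f ⁻¹ᵁ V from hxV) (f ⁻¹ᵁ V).2
  replace hUV : U ≤ f ⁻¹ᵁ V := hUV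
  -- Flat morphisms locally of finite presentation are open. Shrinking to a basic open inside the
  -- image of `U` gives a surjection between affine schemes, so the affine case applies.
  let W : Z.Opens := ⟨f '' U, f.isOpenMap _ U.2⟩
  obtain ⟨r, hrW, hxr⟩ := hV.exists_basicOpen_le (V := W) ⟨f x, ⟨x, hxU, rfl⟩⟩ hxV
  have hV' := hV.basicOpen r
  have hU' := hU.basicOpen (f.appLE V U hUV r)
  have hUV' : X.basicOpen (f.appLE V U hUV r) ≤ f ⁻¹ᵁ Z.basicOpen r := by
    rw [Scheme.basicOpen_appLE]; exact inf_le_right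
  have : IsAffine (Z.basicOpen r).toScheme := hV'
  have : IsAffine (X.basicOpen (f.appLE V U hUV r)).toScheme := hU'
  let φ := f.resLE _ _ hUV'
  have : Surjective φ := by
    refine ⟨fun ⟨y, hy⟩ ↦ ?_⟩
    obtain ⟨x', hx', rfl⟩ := hrW hy
    have hx'' : x' ∈ X.basicOpen (f.appLE V U hUV r) := by
      rw [Scheme.basicOpen_appLE]; exact ⟨hx', hy⟩
    exact ⟨⟨x', hx''⟩, Subtype.ext (by simp [φ])⟩
  refine ⟨Z.basicOpen r, hxr, hV', ?_⟩
  have h1 := Scheme.Hom.isPullback_resLE h.flip (UX := g ⁻¹ᵁ Z.basicOpen r) hUV' le_rfl rfl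
  have h2 : snd ⁻¹ᵁ g ⁻¹ᵁ Z.basicOpen r ⊓ fst ⁻¹ᵁ X.basicOpen (f.appLE V U hUV r) =
      fst ⁻¹ᵁ X.basicOpen (f.appLE V U hUV r) := by
    rw [inf_eq_right, ← Scheme.Hom.comp_preimage, ← h.w, Scheme.Hom.comp_preimage]
    exact fst.preimage_mono hUV'
  have h3 : IsAffineOpen (snd ⁻¹ᵁ g ⁻¹ᵁ Z.basicOpen r ⊓
      fst ⁻¹ᵁ X.basicOpen (f.appLE V U hUV r)) := by
    rw [h2]
    exact hU'.preimage fst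
  have : IsAffine (snd ⁻¹ᵁ g ⁻¹ᵁ Z.basicOpen r ⊓
    fst ⁻¹ᵁ X.basicOpen (f.appLE V U hUV r) : A.Opens).toScheme := h3
  have : Flat φ := inferInstance
  exact isAffine_of_isPullback h1.flip

end Descent

/-! ### Quasi-affine schemes and morphisms -/

section QuasiAffine

/-- Up to the isomorphism on global sections, `f` is `X.toSpecΓ`, an open immersion for quasi-affine
`X`. -/
lemma isOpenImmersion_of_isIso_appTop {X Y : Scheme.{u}} (f : X ⟶ Y) [X.IsQuasiAffine] [IsAffine Y]
    [IsIso f.appTop] : IsOpenImmersion f := by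
  have : IsOpenImmersion (f ≫ Y.toSpecΓ) := by
    rw [Scheme.toSpecΓ_naturality]
    infer_instance
  exact .of_comp f Y.toSpecΓ

lemma isQuasiAffine_of_basicOpen {X : Scheme.{u}} [CompactSpace X] [QuasiSeparatedSpace X]
    (s : Set Γ(X, ⊤)) (hs : ∀ x, ∃ f ∈ s, x ∈ X.basicOpen f)
    (H : ∀ f ∈ s, (X.basicOpen f).toScheme.IsQuasiAffine) : X.IsQuasiAffine := by
  refine .of_forall_exists_mem_basicOpen _ fun x ↦ ?_
  obtain ⟨f, hf, hx⟩ := hs x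
  have := H f hf
  obtain ⟨_, ⟨_, ⟨r, hr, rfl⟩, rfl⟩, hxr, -⟩ := (IsQuasiAffine.isBasis_basicOpen
    (X.basicOpen f).toScheme).exists_subset_of_mem_open (Set.mem_univ ⟨x, hx⟩) isOpen_univ
  let r' : Γ(X, X.basicOpen f) := (X.basicOpen f).topIso.hom r
  let := (X.presheaf.map (homOfLE (X.basicOpen_le f)).op).hom.toAlgebra
  have := isLocalization_basicOpen_of_qcqs isCompact_univ isQuasiSeparated_univ f
  -- A function on `D(f)` is `m / f ^ n` with `m` global, and its nonvanishing locus in `D(f)` is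
  -- `D(f * m)`.
  obtain ⟨n, m, hm⟩ := IsLocalization.Away.surj f r'
  refine ⟨f * m, ?_⟩
  have h1 : X.basicOpen (f * m) = (X.basicOpen f).ι ''ᵁ (X.basicOpen f).toScheme.basicOpen r := by
    have h2 : X.basicOpen r' = (X.basicOpen f).ι ''ᵁ (X.basicOpen f).toScheme.basicOpen r := by
      rw [← Scheme.Opens.ι_image_basicOpen_topIso_inv]
      exact congr((X.basicOpen f).ι ''ᵁ (X.basicOpen f).toScheme.basicOpen
        $(Iso.hom_inv_id_apply (X.basicOpen f).topIso r))
    have h3 : X.basicOpen (algebraMap _ Γ(X, X.basicOpen f) m) = X.basicOpen f ⊓ X.basicOpen m :=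
      X.basicOpen_res _ _
    have h4 : X.basicOpen (algebraMap _ Γ(X, X.basicOpen f) f ^ n) = X.basicOpen f :=
      X.basicOpen_of_isUnit ((IsLocalization.Away.algebraMap_isUnit f).pow n)
    rw [Scheme.basicOpen_mul, ← h3, ← hm, Scheme.basicOpen_mul, ← h2, h4]
    exact inf_eq_left.mpr (X.basicOpen_le _)
  rw [h1]
  exact ⟨hr.image_of_isOpenImmersion _, ⟨_, hxr, rfl⟩⟩

lemma isQuasiAffine_of_iso {X Y : Scheme.{u}} (e : X ≅ Y) [Y.IsQuasiAffine] : X.IsQuasiAffine :=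
  .of_isAffineHom e.hom

lemma isSeparated_of_isQuasiAffineHom {X Y : Scheme.{u}} (f : X ⟶ Y) [IsQuasiAffineHom f] :
    IsSeparated f := by
  refine IsZariskiLocalAtTarget.of_iSup_eq_top (P := @IsSeparated) _ (iSup_affineOpens_eq_top Y)
    fun U ↦ ?_
  have := IsQuasiAffineHom.isQuasiAffine_preimage (f := f) U.1 U.2
  infer_instance

lemma quasiCompact_of_isQuasiAffineHom {X Y : Scheme.{u}} (f : X ⟶ Y) [IsQuasiAffineHom f] :
    QuasiCompact f := by
  rw [quasiCompact_iff_forall_isAffineOpen]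
  intro U hU
  have := IsQuasiAffineHom.isQuasiAffine_preimage (f := f) U hU
  exact isCompact_iff_compactSpace.mpr (inferInstanceAs (CompactSpace (f ⁻¹ᵁ U).toScheme))

lemma isQuasiAffine_basicOpen {X : Scheme.{u}} {U : X.Opens} (hU : U.toScheme.IsQuasiAffine)
    (r : Γ(X, U)) : (X.basicOpen r).toScheme.IsQuasiAffine := by
  have : CompactSpace (X.basicOpen r) := isCompact_iff_compactSpace.mp
    (isCompact_basicOpen X (isCompact_iff_compactSpace.mpr (inferInstanceAs (CompactSpace U.toScheme))) r)
  exact .of_isImmersion (X.homOfLE (X.basicOpen_le r))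

lemma isQuasiAffineHom_of_isPullback {A X Y Z : Scheme.{u}} {fst : A ⟶ X} {snd : A ⟶ Y} {f : X ⟶ Z}
    {g : Y ⟶ Z} (h : IsPullback fst snd f g) [IsQuasiAffineHom g] : IsQuasiAffineHom fst := by
  have : IsSeparated fst := MorphismProperty.of_isPullback h.flip (isSeparated_of_isQuasiAffineHom g)
  have : QuasiCompact fst :=
    MorphismProperty.of_isPullback h.flip (quasiCompact_of_isQuasiAffineHom g)
  refine ⟨fun U hU ↦ ?_⟩
  let ι := {P : X.affineOpens × Z.affineOpens // P.1.1 ≤ f ⁻¹ᵁ P.2.1}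
  -- Affine communication lemma, for the cover by affine opens of `X` that map into an affine open
  -- of `Z`; over these, the preimage is affine over a quasi-affine scheme.
  refine of_affine_open_cover (P := fun U ↦ (fst ⁻¹ᵁ U.1).toScheme.IsQuasiAffine)
    (fun i : ι ↦ i.1.1) ?_ ⟨U, hU⟩ ?_ ?_ ?_
  · refine top_le_iff.mp fun x _ ↦ ?_
    obtain ⟨_, ⟨V, hV, rfl⟩, hxV, -⟩ :=
      Z.isBasis_affineOpens.exists_subset_of_mem_open (Set.mem_univ (f x)) isOpen_univ
    obtain ⟨_, ⟨U, hU, rfl⟩, hxU, hUV⟩ :=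
      X.isBasis_affineOpens.exists_subset_of_mem_open (show x ∈ f ⁻¹ᵁ V from hxV) (f ⁻¹ᵁ V).2
    exact TopologicalSpace.Opens.mem_iSup.mpr ⟨⟨⟨⟨U, hU⟩, ⟨V, hV⟩⟩, hUV⟩, hxU⟩
  · intro U r hU
    change (fst ⁻¹ᵁ X.basicOpen r).toScheme.IsQuasiAffine
    rw [Scheme.preimage_basicOpen]
    exact isQuasiAffine_basicOpen hU _
  · intro U s hs H
    have : CompactSpace (fst ⁻¹ᵁ U.1) :=
      isCompact_iff_compactSpace.mp (fst.isCompact_preimage U.2.isCompact)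
    have : QuasiSeparatedSpace (fst ⁻¹ᵁ U.1) :=
      (isQuasiSeparated_iff_quasiSeparatedSpace _ (fst ⁻¹ᵁ U.1).2).mp
        (fst.isQuasiSeparated_preimage U.2.isQuasiSeparated)
    have h1 (r : Γ(X, U.1)) : (fst ⁻¹ᵁ U.1).ι ''ᵁ (fst ⁻¹ᵁ U.1).toScheme.basicOpen
        ((fst ⁻¹ᵁ U.1).topIso.inv (fst.app U.1 r)) = fst ⁻¹ᵁ X.basicOpen r := by
      rw [Scheme.Opens.ι_image_basicOpen_topIso_inv, Scheme.preimage_basicOpen]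
    refine isQuasiAffine_of_basicOpen ((fun r ↦ (fst ⁻¹ᵁ U.1).topIso.inv (fst.app U.1 r)) '' s) ?_ ?_
    · intro x
      have h2 := (U.2.iSup_basicOpen_eq_self_iff.mpr hs).ge x.2
      obtain ⟨r, hr⟩ := TopologicalSpace.Opens.mem_iSup.mp h2
      refine ⟨_, ⟨r.1, r.2, rfl⟩, ?_⟩
      have h3 : x.1 ∈ fst ⁻¹ᵁ X.basicOpen r.1 := hr
      rw [← h1] at h3
      obtain ⟨y, hy, hyx⟩ := h3
      rwa [← Subtype.ext hyx]
    · rintro _ ⟨r, hr, rfl⟩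
      have h2 : (fst ⁻¹ᵁ X.basicOpen r).toScheme.IsQuasiAffine := H ⟨r, hr⟩
      rw [← h1] at h2
      exact isQuasiAffine_of_iso ((fst ⁻¹ᵁ U.1).ι.isoImage _)
  · rintro ⟨⟨U, V⟩, hUV⟩
    have h2 : fst ⁻¹ᵁ U.1 = snd ⁻¹ᵁ g ⁻¹ᵁ V.1 ⊓ fst ⁻¹ᵁ U.1 := by
      rw [eq_comm, inf_eq_right, ← Scheme.Hom.comp_preimage, ← h.w, Scheme.Hom.comp_preimage]
      exact fst.preimage_mono hUV
    have h3 := Scheme.Hom.isPullback_resLE h.flip hUV le_rfl h2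
    have : IsAffine U.1.toScheme := U.2
    have : IsAffine V.1.toScheme := V.2
    have : IsAffineHom (snd.resLE (g ⁻¹ᵁ V.1) (fst ⁻¹ᵁ U.1) (h2.trans_le inf_le_left)) :=
      MorphismProperty.of_isPullback h3.flip (inferInstance : IsAffineHom (f.resLE V.1 U.1 hUV))
    have := IsQuasiAffineHom.isQuasiAffine_preimage (f := g) V.1 V.2
    exact .of_isAffineHom (snd.resLE (g ⁻¹ᵁ V.1) (fst ⁻¹ᵁ U.1) (h2.trans_le inf_le_left))

end QuasiAffine

/-! ### Algebra descent restated with pushout squares of rings -/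

section PushoutOfInvariants

lemma productMap_bijective_of_isPushout {R A B C : CommRingCat.{u}} {f : R ⟶ A} {g : R ⟶ B}
    {i : A ⟶ C} {j : B ⟶ C} (h : IsPushout f g i j) :
    letI := f.hom.toAlgebra
    letI := g.hom.toAlgebra
    letI := (f ≫ i).hom.toAlgebra
    Function.Bijective (Algebra.TensorProduct.productMap (⟨i.hom, fun _ ↦ rfl⟩ : A →ₐ[R] C)
      (⟨j.hom, fun x ↦ congr($(h.w.symm) x)⟩ : B →ₐ[R] C)) := by
  let := f.hom.toAlgebra
  let := g.hom.toAlgebra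
  let := (f ≫ i).hom.toAlgebra
  have h1 := CommRingCat.isPushout_tensorProduct R A B
  have h2 : (h1.isoIsPushout _ _ h).hom = CommRingCat.ofHom
    (Algebra.TensorProduct.productMap (⟨i.hom, fun _ ↦ rfl⟩ : A →ₐ[R] C)
      (⟨j.hom, fun x ↦ congr($(h.w.symm) x)⟩ : B →ₐ[R] C)).toRingHom := by
    apply h1.hom_ext
    · rw [IsPushout.inl_isoIsPushout_hom]
      ext x
      simp
    · rw [IsPushout.inr_isoIsPushout_hom]
      ext x
      simp
  have h3 := ConcreteCategory.bijective_of_isIso (h1.isoIsPushout _ _ h).hom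
  rw [h2] at h3
  exact h3

lemma isPushout_of_productMap_bijective {R A B C : CommRingCat.{u}} {f : R ⟶ A} {g : R ⟶ B}
    {i : A ⟶ C} {j : B ⟶ C} (w : f ≫ i = g ≫ j)
    (h : letI := f.hom.toAlgebra
    letI := g.hom.toAlgebra
    letI := (f ≫ i).hom.toAlgebra
    Function.Bijective (Algebra.TensorProduct.productMap (⟨i.hom, fun _ ↦ rfl⟩ : A →ₐ[R] C)
      (⟨j.hom, fun x ↦ congr($(w.symm) x)⟩ : B →ₐ[R] C))) : IsPushout f g i j := by
  let := f.hom.toAlgebra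
  let := g.hom.toAlgebra
  let := (f ≫ i).hom.toAlgebra
  let e := (RingEquiv.ofBijective _ h).toCommRingCatIso
  refine (CommRingCat.isPushout_tensorProduct R A B).of_iso (.refl _) (.refl _) (.refl _) e
    ?_ ?_ ?_ ?_
  · rfl
  · rfl
  · ext x
    exact Algebra.TensorProduct.productMap_left_apply _ _ x
  · ext x
    exact Algebra.TensorProduct.productMap_right_apply _ _ x

/-- `bijective_productMap_equalizer` in the category of commutative rings. -/
lemma isPushout_eqLocus {R R' M N L : CommRingCat.{u}} {p : R ⟶ R'} {m : R ⟶ M} {a s : M ⟶ N}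
    {z : R' ⟶ M} {e : N ⟶ M} {u v d : N ⟶ L} (hp : p.hom.Flat) (hz : p ≫ z = m)
    (hN : IsPushout p m (z ≫ a) s) (hL : IsPushout p (m ≫ s) (z ≫ a ≫ v) u)
    (ha : a ≫ e = 𝟙 M) (hva : a ≫ v = a ≫ d) (hvs : s ≫ v = a ≫ u) (hds : s ≫ d = s ≫ u)
    {m₀ : R ⟶ .of (a.hom.eqLocus s.hom)}
    (hm₀ : m₀ ≫ CommRingCat.ofHom (a.hom.eqLocus s.hom).subtype = m) :
    IsPushout p m₀ z (CommRingCat.ofHom (a.hom.eqLocus s.hom).subtype) := by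
  subst hz
  let := p.hom.toAlgebra
  let := (p ≫ z).hom.toAlgebra
  let := (p ≫ z ≫ a).hom.toAlgebra
  let := (p ≫ z ≫ a ≫ v).hom.toAlgebra
  have has : p ≫ z ≫ a = p ≫ z ≫ s := by
    rw [hN.w, Category.assoc]
  rw [Category.assoc, ← has] at hL
  have : Module.Flat R R' := hp
  have key := bijective_productMap_equalizer (R := R) (R' := R')
    (⟨a.hom, fun x ↦ rfl⟩ : M →ₐ[R] N)
    (⟨s.hom, fun x ↦ congr($(has.symm) x)⟩ : M →ₐ[R] N) (⟨z.hom, fun x ↦ rfl⟩ : R' →ₐ[R] M)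
    (⟨e.hom, fun x ↦ congr($ha (z (p x)))⟩ : N →ₐ[R] M)
    (⟨u.hom, fun x ↦ congr($(hvs.symm) (z (p x))).trans congr(v ($(has.symm) x))⟩ : N →ₐ[R] L)
    (⟨v.hom, fun x ↦ rfl⟩ : N →ₐ[R] L)
    (⟨d.hom, fun x ↦ congr($(hva.symm) (z (p x)))⟩ : N →ₐ[R] L)
    (productMap_bijective_of_isPushout hN) (productMap_bijective_of_isPushout hL).1
    (AlgHom.ext fun x ↦ congr($ha x)) (AlgHom.ext fun x ↦ congr($hva x))
    (AlgHom.ext fun x ↦ congr($hvs x)) (AlgHom.ext fun x ↦ congr($hds x))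
  let := m₀.hom.toAlgebra
  let φ : CommRingCat.of (a.hom.eqLocus s.hom) ≃ₐ[R] AlgHom.equalizer
      (⟨a.hom, fun x ↦ rfl⟩ : M →ₐ[R] N) (⟨s.hom, fun x ↦ congr($(has.symm) x)⟩ : M →ₐ[R] N) :=
    { toFun x := ⟨x.1, x.2⟩
      invFun x := ⟨x.1, x.2⟩
      left_inv _ := rfl
      right_inv _ := rfl
      map_mul' _ _ := rfl
      map_add' _ _ := rfl
      commutes' x := Subtype.ext congr($hm₀ x) }
  refine isPushout_of_productMap_bijective hm₀.symm ?_
  convert! key.comp (Algebra.TensorProduct.congr (AlgEquiv.refl (R := R) (A₁ := R')) φ).bijective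
  rw [← AlgEquiv.coe_toAlgHom, ← AlgHom.coe_comp]
  congr 1
  ext x
  · simp
  · simp
    rfl

end PushoutOfInvariants

/-! ### Effective descent of quasi-affine morphisms along `p` -/

section DescentAlongTorsor

lemma appLE_eq_id {X : Scheme.{u}} {f : X ⟶ X} (hf : f = 𝟙 X) {U : X.Opens} (hU : U ≤ f ⁻¹ᵁ U) :
    f.appLE U U hU = 𝟙 _ := by
  subst hf
  rw [Scheme.Hom.appLE, Scheme.Hom.id_app]
  exact (Category.id_comp _).trans (X.presheaf.map_id _)

/-- Flat base change for the qcqs morphism `g`. The opens `U` and `U'` are variables so that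
iterated preimages can stand for preimages under composites. -/
lemma isPushout_appLE_of_isPullback {A X Y Z : Scheme.{u}} {fst : A ⟶ X} {snd : A ⟶ Y} {f : X ⟶ Z}
    {g : Y ⟶ Z} (h : IsPullback fst snd f g) [IsAffineHom f] [Flat f] [QuasiCompact g]
    [QuasiSeparated g] {V : Z.Opens} (hV : IsAffineOpen V) {U : A.Opens} {U' : Y.Opens}
    (hU' : U' = g ⁻¹ᵁ V) (hU : U = snd ⁻¹ᵁ U') (hUX : U ≤ fst ⁻¹ᵁ f ⁻¹ᵁ V) :
    IsPushout (f.app V) (g.appLE V U' hU'.le) (fst.appLE (f ⁻¹ᵁ V) U hUX)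
      (snd.appLE U' U hU.le) := by
  have hUY : U = snd ⁻¹ᵁ U' ⊓ fst ⁻¹ᵁ f ⁻¹ᵁ V := by
    rw [← hU, inf_eq_left.mpr hUX]
  have := (isIso_pushoutSection_iff h.flip le_rfl hU'.le hUY).mp
    (isIso_pushoutSection_of_isQuasiSeparated_of_flat_right _ _ _ _ hV (hV.preimage f)
      (hU' ▸ g.isCompact_preimage hV.isCompact)
      (hU' ▸ g.isQuasiSeparated_preimage hV.isQuasiSeparated))
  simpa only [Scheme.Hom.app_eq_appLE] using! this.flip

-- The model is `E = G × W` and `E₂ = G × G × W`: `a` is the action, `s` the projection, `e` the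
-- unit section, `v = id × a`, `d` multiplies the two group elements, and `u` forgets the first. The
-- torsor condition enters as `E ≅ Z ×_B W` and `E₂ ≅ Z ×_B E`.
variable {B Z W E E₂ : Scheme.{u}} {p : Z ⟶ B} {z : W ⟶ Z} {q : W ⟶ B} {a s : E ⟶ W} {e : W ⟶ E}
  {u v d : E₂ ⟶ E} (hq : z ≫ p = q) (h : a ≫ q = s ≫ q) (hE : IsPullback (a ≫ z) s p q)
  (hE₂ : IsPullback (v ≫ a ≫ z) u p (s ≫ q)) (he : e ≫ a = 𝟙 W) (hva : v ≫ a = d ≫ a)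
  (hvs : v ≫ s = u ≫ a) (hds : d ≫ s = u ≫ s)
  [QuasiCompact q] [QuasiSeparated q]
  [QuasiCompact (s ≫ q)] [QuasiSeparated (s ≫ q)]

instance (V : B.Opens) : Mono (invariantsVal a s q h V) :=
  ConcreteCategory.mono_of_injective _ Subtype.val_injective

lemma preimage_eq_toAffineHull_preimage (V : B.Opens) :
    q ⁻¹ᵁ V = toAffineHull a s q h ⁻¹ᵁ fromAffineHull a s q h ⁻¹ᵁ V := by
  rw [← Scheme.Hom.comp_preimage, toAffineHull_fromAffineHull]

/-- The morphism to the base change along `p` of the affine hull. -/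
noncomputable def toAffineHullPullback : W ⟶ pullback p (fromAffineHull a s q h) :=
  pullback.lift z (toAffineHull a s q h) (by simp [hq])

lemma toAffineHullPullback_fst :
    toAffineHullPullback hq h ≫ pullback.fst p (fromAffineHull a s q h) = z :=
  pullback.lift_fst _ _ _

lemma toAffineHullPullback_snd :
    toAffineHullPullback hq h ≫ pullback.snd p (fromAffineHull a s q h) =
      toAffineHull a s q h :=
  pullback.lift_snd _ _ _

lemma toAffineHullPullback_preimage (V : B.Opens) :
    toAffineHullPullback hq h ⁻¹ᵁ
      pullback.snd p (fromAffineHull a s q h) ⁻¹ᵁ fromAffineHull a s q h ⁻¹ᵁ V = q ⁻¹ᵁ V := by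
  rw [← Scheme.Hom.comp_preimage (toAffineHullPullback hq h), toAffineHullPullback_snd,
    ← preimage_eq_toAffineHull_preimage h V]

variable [IsAffineHom p] [Flat p]

include hE hE₂ he hva hvs hds in
/-- The ring of functions on `W` is the base change along `p` of the ring of invariants. -/
lemma isPushout_invariantsVal {V : B.Opens} (hV : IsAffineOpen V) :
    IsPushout (p.app V) ((invariantsPresheafMap a s q h).app (.op V))
      (z.appLE (p ⁻¹ᵁ V) (q ⁻¹ᵁ V) (by rw [← hq]; rfl)) (invariantsVal a s q h V) := by
  have e0 : q ⁻¹ᵁ V ≤ z ⁻¹ᵁ p ⁻¹ᵁ V := by rw [← hq]; rfl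
  have e1 : q ⁻¹ᵁ V ≤ e ⁻¹ᵁ s ⁻¹ᵁ q ⁻¹ᵁ V := by
    rw [← Scheme.Hom.comp_preimage s, ← h, ← Scheme.Hom.comp_preimage e, reassoc_of% he]
  have e2 : u ⁻¹ᵁ s ⁻¹ᵁ q ⁻¹ᵁ V ≤ v ⁻¹ᵁ s ⁻¹ᵁ q ⁻¹ᵁ V := by
    rw [← Scheme.Hom.comp_preimage v, hvs, Scheme.Hom.comp_preimage, ← Scheme.Hom.comp_preimage a, h,
      Scheme.Hom.comp_preimage]
  have e3 : u ⁻¹ᵁ s ⁻¹ᵁ q ⁻¹ᵁ V ≤ d ⁻¹ᵁ s ⁻¹ᵁ q ⁻¹ᵁ V := by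
    rw [← Scheme.Hom.comp_preimage d, hds, Scheme.Hom.comp_preimage]
  have e4 := preimage_le_of_comp_eq a s q h V
  refine isPushout_eqLocus (m := q.app V) (e := e.appLE _ _ e1) (u := u.app _)
    (v := v.appLE _ _ e2) (d := d.appLE _ _ e3) (by
    simpa only [Scheme.Hom.app_eq_appLE] using! p.flat_appLE hV (hV.preimage p) le_rfl) ?_ ?_ ?_ ?_ ?_ ?_ ?_ rfl
  · simp only [Scheme.Hom.app_eq_appLE, Scheme.Hom.appLE_comp_appLE, hq]
  · have := isPushout_appLE_of_isPullback hE hV (U := s ⁻¹ᵁ q ⁻¹ᵁ V) rfl rfl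
      (e4.trans (a.preimage_mono e0))
    simpa only [Scheme.Hom.app_eq_appLE, Scheme.Hom.appLE_comp_appLE] using! this
  · have := isPushout_appLE_of_isPullback hE₂ hV (U := u ⁻¹ᵁ s ⁻¹ᵁ q ⁻¹ᵁ V)
      (U' := s ⁻¹ᵁ q ⁻¹ᵁ V) rfl rfl (e2.trans (v.preimage_mono (e4.trans (a.preimage_mono e0))))
    simpa only [Scheme.Hom.app_eq_appLE, Scheme.Hom.appLE_comp_appLE] using! this
  · rw [Scheme.Hom.appLE_comp_appLE]
    exact appLE_eq_id he _
  · simp only [Scheme.Hom.appLE_comp_appLE, hva]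
  · simp only [Scheme.Hom.app_eq_appLE, Scheme.Hom.appLE_comp_appLE, hvs]
  · simp only [Scheme.Hom.app_eq_appLE, Scheme.Hom.appLE_comp_appLE, hds]

include hE hE₂ he hva hvs hds in
lemma isPushout_toAffineHull {V : B.Opens} (hV : IsAffineOpen V) :
    IsPushout (p.app V) ((fromAffineHull a s q h).appLE V (fromAffineHull a s q h ⁻¹ᵁ V) le_rfl)
      (z.appLE (p ⁻¹ᵁ V) (q ⁻¹ᵁ V) (by rw [← hq]; rfl))
      ((toAffineHull a s q h).appLE (fromAffineHull a s q h ⁻¹ᵁ V) (q ⁻¹ᵁ V)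
        (preimage_eq_toAffineHull_preimage h V).le) := by
  have h1 := affineHullObjIso_hom_val a s q h hV
  refine (isPushout_invariantsVal hq h hE hE₂ he hva hvs hds hV).of_iso (.refl _) (.refl _)
    (affineHullObjIso a s q h hV).symm (.refl _) ?_ ?_ ?_ ?_
  · simp
  · rw [← cancel_mono (affineHullObjIso a s q h hV).hom,
      ← cancel_mono (invariantsVal a s q h V)]
    simp only [Iso.symm_hom, Category.assoc, Iso.inv_hom_id, Category.comp_id, h1, Iso.refl_hom]
    rw [Category.id_comp, Scheme.Hom.appLE_comp_appLE]
    simp only [toAffineHull_fromAffineHull]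
    rw [← Scheme.Hom.app_eq_appLE]
    rfl
  · simp
  · rw [← h1]
    simp

include hE hE₂ he hva hvs hds in
-- Both rings are pushouts of the same span: one by flat base change of the hull, the other by
-- descent of algebras.
lemma isIso_toAffineHullPullback_appLE {V : B.Opens} (hV : IsAffineOpen V) :
    IsIso ((toAffineHullPullback hq h).appLE
      (pullback.snd p (fromAffineHull a s q h) ⁻¹ᵁ fromAffineHull a s q h ⁻¹ᵁ V) (q ⁻¹ᵁ V)
      (toAffineHullPullback_preimage hq h V).ge) := by
  have h1 := isPushout_appLE_of_isPullback (IsPullback.of_hasPullback p (fromAffineHull a s q h)) hV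
    (U' := fromAffineHull a s q h ⁻¹ᵁ V) rfl
    (U := pullback.snd p (fromAffineHull a s q h) ⁻¹ᵁ fromAffineHull a s q h ⁻¹ᵁ V) rfl
    (by rw [← Scheme.Hom.comp_preimage, ← pullback.condition]; rfl)
  have h2 := isPushout_toAffineHull hq h hE hE₂ he hva hvs hds hV
  convert! (inferInstance : IsIso (h1.isoIsPushout _ _ h2).hom)
  apply h1.hom_ext
  · rw [IsPushout.inl_isoIsPushout_hom, Scheme.Hom.appLE_comp_appLE]
    simp only [toAffineHullPullback_fst]
  · rw [IsPushout.inr_isoIsPushout_hom, Scheme.Hom.appLE_comp_appLE]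
    simp only [toAffineHullPullback_snd]

lemma isIso_morphismRestrict_appTop {X Y : Scheme.{u}} (f : X ⟶ Y) (U : Y.Opens) {V : X.Opens}
    (hV : f ⁻¹ᵁ U = V) (H : IsIso (f.appLE U V hV.ge)) : IsIso (f ∣_ U).appTop := by
  subst hV
  rw [← Scheme.Hom.resLE_eq_morphismRestrict]
  exact (MorphismProperty.arrow_mk_iso_iff (.isomorphisms _) (arrowResLEAppIso f U _ le_rfl)).mpr H

include hE hE₂ he hva hvs hds in
-- Over an affine open of `B`, this is a morphism from a quasi-affine scheme to an affine one
-- inducing an isomorphism on functions.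
lemma isOpenImmersion_toAffineHullPullback [IsQuasiAffineHom z] :
    IsOpenImmersion (toAffineHullPullback hq h) := by
  refine IsZariskiLocalAtTarget.of_iSup_eq_top (P := @IsOpenImmersion) (fun V : B.affineOpens ↦
    pullback.snd p (fromAffineHull a s q h) ⁻¹ᵁ fromAffineHull a s q h ⁻¹ᵁ V.1)
    (TopologicalSpace.IsOpenCover.comap (.comap (iSup_affineOpens_eq_top B)
      (fromAffineHull a s q h).base.1) (pullback.snd p (fromAffineHull a s q h)).base.1) fun V ↦ ?_
  have := isIso_morphismRestrict_appTop _ _ (toAffineHullPullback_preimage hq h V.1)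
    (isIso_toAffineHullPullback_appLE hq h hE hE₂ he hva hvs hds V.2)
  have h1 : (toAffineHullPullback hq h ⁻¹ᵁ pullback.snd p (fromAffineHull a s q h) ⁻¹ᵁ
      fromAffineHull a s q h ⁻¹ᵁ V.1).toScheme.IsQuasiAffine := by
    rw [toAffineHullPullback_preimage, ← hq]
    exact IsQuasiAffineHom.isQuasiAffine_preimage (f := z) (p ⁻¹ᵁ V.1) (V.2.preimage p)
  have h2 : IsAffineHom (pullback.snd p (fromAffineHull a s q h)) :=
    MorphismProperty.of_isPullback (IsPullback.of_hasPullback p (fromAffineHull a s q h))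
      (inferInstance : IsAffineHom p)
  have : IsAffine (pullback.snd p (fromAffineHull a s q h) ⁻¹ᵁ
      fromAffineHull a s q h ⁻¹ᵁ V.1).toScheme :=
    (V.2.preimage (fromAffineHull a s q h)).preimage (pullback.snd p (fromAffineHull a s q h))
  exact isOpenImmersion_of_isIso_appTop _

/-- An open subscheme of an affine scheme is quasi-affine once it is quasi-compact; compactness is
transported along the surjection `r`. -/
lemma isQuasiAffineHom_of_isAffineHom_of_surjective {W X Y B : Scheme.{u}} (i : X ⟶ Y) (g : Y ⟶ B)
    (r : W ⟶ X) [IsOpenImmersion i] [IsAffineHom g] [Surjective r] [QuasiCompact (r ≫ i ≫ g)] :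
    IsQuasiAffineHom (i ≫ g) := by
  refine ⟨fun V hV ↦ ?_⟩
  have : IsAffine (g ⁻¹ᵁ V).toScheme := hV.preimage g
  have h1 : IsCompact (r ⁻¹' ((i ≫ g) ⁻¹ᵁ V : X.Opens)) :=
    (r ≫ i ≫ g).isCompact_preimage hV.isCompact
  have h2 := h1.image r.continuous
  rw [Set.image_preimage_eq _ r.surjective] at h2
  have : CompactSpace ((i ≫ g) ⁻¹ᵁ V) := isCompact_iff_compactSpace.mp h2
  change (i ⁻¹ᵁ g ⁻¹ᵁ V).toScheme.IsQuasiAffine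
  have : CompactSpace (i ⁻¹ᵁ g ⁻¹ᵁ V) := this
  exact .of_isImmersion (i ∣_ g ⁻¹ᵁ V)

/-- An open subscheme of the source of `snd` with a descent datum descends to an open subscheme. -/
lemma exists_isPullback_of_isOpenImmersion {W E P X : Scheme.{u}} {snd : P ⟶ X} {j : W ⟶ P}
    {a s : E ⟶ W} [IsOpenImmersion j] [Flat snd] [LocallyOfFinitePresentation snd]
    (hE : IsPullback (a ≫ j) s snd (j ≫ snd)) :
    ∃ (U : X.Opens) (r : W ⟶ U), IsPullback j r snd U.ι := by
  let U : X.Opens := ⟨Set.range (j ≫ snd), by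
    rw [Scheme.Hom.comp_base, TopCat.coe_comp, Set.range_comp]
    exact snd.isOpenMap _ j.isOpenEmbedding.isOpen_range⟩
  let Q := snd ⁻¹ᵁ U
  have hQ : IsPullback Q.ι (snd ∣_ U) snd U.ι := (isPullback_morphismRestrict _ _).flip
  let j' : W ⟶ Q := IsOpenImmersion.lift Q.ι j (by
    rintro _ ⟨x, rfl⟩
    rw [Scheme.Opens.range_ι]
    exact ⟨x, rfl⟩)
  have hj' : j' ≫ Q.ι = j := IsOpenImmersion.lift_fac _ _ _
  have : IsOpenImmersion j' := by
    have : IsOpenImmersion (j' ≫ Q.ι) := hj' ▸ ‹_›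
    exact .of_comp j' Q.ι
  -- A point `x` over `U` has the same image in `X` as some `w` in `W`. The pair lifts to `P ×_X W ≅
  -- E`, whose projection to `P` factors through `j`, so `x` lies in `W`.
  have : Surjective j' := by
    refine ⟨fun x ↦ ?_⟩
    obtain ⟨w, hw⟩ := x.2
    obtain ⟨y, hy, -⟩ := Scheme.Pullback.exists_preimage_pullback x.1 w hw.symm
    refine ⟨a (hE.isoPullback.inv y), Subtype.ext ?_⟩
    have h1 : hE.isoPullback.inv ≫ a ≫ j' ≫ Q.ι = pullback.fst _ _ := by
      rw [hj', IsPullback.isoPullback_inv_fst]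
    exact congr($h1 y).trans hy
  have : IsIso j' := (isIso_iff_isOpenImmersion_and_epi_base j').mpr ⟨‹_›,
    (TopCat.epi_iff_surjective _).mpr j'.surjective⟩
  exact ⟨U, j' ≫ (snd ∣_ U), .of_iso hQ (asIso j').symm (.refl _) (.refl _) (.refl _)
    (by simp [hj']) (by simp) (by simp) (by simp)⟩

include hq hE hE₂ he hva hvs hds h in
/-- Descent of quasi-affine morphisms along the torsor `p`. -/
theorem exists_isPullback_isQuasiAffineHom [IsQuasiAffineHom z] [Surjective p]
    [LocallyOfFinitePresentation p] : ∃ (X : Scheme.{u}) (f : X ⟶ B) (r : W ⟶ X),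
      IsPullback z r p f ∧ a ≫ r = s ≫ r ∧ IsQuasiAffineHom f := by
  have := isOpenImmersion_toAffineHullPullback hq h hE hE₂ he hva hvs hds
  have hP := IsPullback.of_hasPullback p (fromAffineHull a s q h)
  have h1 : Flat (pullback.snd p (fromAffineHull a s q h)) :=
    MorphismProperty.of_isPullback hP ‹Flat p›
  have h2 : LocallyOfFinitePresentation (pullback.snd p (fromAffineHull a s q h)) :=
    MorphismProperty.of_isPullback hP ‹LocallyOfFinitePresentation p›
  have hac := comp_toAffineHull a s q h
  have hE' : IsPullback (a ≫ toAffineHullPullback hq h) s (pullback.snd p (fromAffineHull a s q h))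
      (toAffineHullPullback hq h ≫ pullback.snd p (fromAffineHull a s q h)) := by
    rw [toAffineHullPullback_snd]
    refine IsPullback.of_right ?_ ?_ hP
    · rwa [Category.assoc, toAffineHullPullback_fst, toAffineHull_fromAffineHull]
    · rw [Category.assoc, toAffineHullPullback_snd, hac]
  obtain ⟨U, r, hr⟩ := exists_isPullback_of_isOpenImmersion hE'
  have hW : IsPullback z r p (U.ι ≫ fromAffineHull a s q h) := by
    rw [← toAffineHullPullback_fst hq h]
    exact hr.flip.paste_vert hP.flip |>.flip
  have h3 : Surjective r := MorphismProperty.of_isPullback hW ‹Surjective p›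
  have h4 : r ≫ U.ι = toAffineHull a s q h := hr.w.symm.trans (toAffineHullPullback_snd hq h)
  have : QuasiCompact (r ≫ U.ι ≫ fromAffineHull a s q h) := by
    rw [reassoc_of% h4, toAffineHull_fromAffineHull]
    infer_instance
  refine ⟨U, U.ι ≫ fromAffineHull a s q h, r, hW, ?_,
    isQuasiAffineHom_of_isAffineHom_of_surjective _ _ r⟩
  rw [← cancel_mono U.ι, Category.assoc, Category.assoc, h4, hac]

end DescentAlongTorsor

open scoped MonObj

/-! ### Torsors: base change, descent of morphisms, cartesian squares -/

section Torsors

lemma isPullback_whiskerLeft_snd {C : Type*} [Category* C] [CartesianMonoidalCategory C] (G : C)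
    {P W : C} (φ : P ⟶ W) : IsPullback (G ◁ φ) (snd G P) (snd G W) φ := by
  refine ⟨⟨by simp⟩, ⟨PullbackCone.IsLimit.mk _ (fun s ↦ lift (s.fst ≫ fst G W) s.snd)
    (fun s ↦ ?_) (fun s ↦ by simp) (fun s m h1 h2 ↦ ?_)⟩⟩
  · ext1
    · simp
    · simpa using s.condition.symm
  · ext1
    · simp [← h1]
    · simpa using h2

section

variable {C : Type*} [Category* C] [CartesianMonoidalCategory C] {G P W X T : C} [MonObj G]
  [ModObj G W] {φ : P ⟶ W} {π : P ⟶ T} {r : W ⟶ X} {k : T ⟶ X}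

/-- The action on the base change of a scheme with an action for which `r` is invariant. -/
@[reducible]
noncomputable def pullbackAction (h : IsPullback φ π r k) (hr : γ[G, W] ≫ r = snd G W ≫ r) : ModObj G P where
  smul := h.lift (G ◁ φ ≫ γ[G, W]) (snd G P ≫ π) (by
    rw [Category.assoc, hr, whiskerLeft_snd_assoc, Category.assoc, h.w])
  one_smul := by
    change η[G] ▷ P ≫ h.lift _ _ _ = (λ_ P).hom
    apply h.hom_ext
    · rw [Category.assoc, h.lift_fst, ← whisker_exchange_assoc, ModObj.one_smul_self,
        leftUnitor_naturality]
    · simp [leftUnitor_hom]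
  mul_smul := by
    change μ[G] ▷ P ≫ h.lift _ _ _ = (α_ G G P).hom ≫ G ◁ h.lift _ _ _ ≫ h.lift _ _ _
    apply h.hom_ext
    · simp only [Category.assoc, h.lift_fst]
      rw [← whisker_exchange_assoc, ModObj.mul_smul_self, ← whiskerLeft_comp_assoc, h.lift_fst]
      simp
    · simp

lemma pullbackAction_isModHom (h : IsPullback φ π r k) (hr : γ[G, W] ≫ r = snd G W ≫ r) :
    letI := pullbackAction h hr
    IsModHom G φ := by
  let := pullbackAction h hr
  exact ⟨h.lift_fst _ _ _⟩

lemma pullbackAction_comp (h : IsPullback φ π r k) (hr : γ[G, W] ≫ r = snd G W ≫ r) :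
    letI := pullbackAction h hr
    γ[G, P] ≫ π = snd G P ≫ π :=
  h.lift_snd _ _ _

lemma isPullback_smul_of_isPullback [ModObj G P] [IsModHom G φ] (h : IsPullback φ π r k)
    (hr : IsPullback γ[G, W] (snd G W) r r) (hπ : γ[G, P] ≫ π = snd G P ≫ π) :
    IsPullback γ[G, P] (snd G P) π π := by
  refine IsPullback.of_right ?_ hπ h
  have h1 := (isPullback_whiskerLeft_snd G φ).paste_horiz hr
  have h2 : γ[G, P] ≫ φ = G ◁ φ ≫ γ[G, W] := IsModHom.smul_hom
  rwa [h2, ← h.w]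

end

variable {S : Scheme.{u}} {G : Over S} [GrpObj G]

lemma isPullback_left {A X Y Z : Over S} {fst : A ⟶ X} {snd : A ⟶ Y} {f : X ⟶ Z} {g : Y ⟶ Z}
    (h : IsPullback fst snd f g) : IsPullback fst.left snd.left f.left g.left :=
  h.map (Over.forget S)

/-- The base change of a torsor is a torsor. -/
lemma IsTorsor.of_isPullback {P W X T : Over S} [ModObj G P] [ModObj G W] {φ : P ⟶ W} {π : P ⟶ T}
    {r : W ⟶ X} {k : T ⟶ X} (hr : IsTorsor G r) [IsModHom G φ] (h : IsPullback φ π r k)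
    (hπ : γ[G, P] ≫ π = snd G P ≫ π) : IsTorsor G π where
  flat := MorphismProperty.of_isPullback (isPullback_left h) hr.flat
  surjective := MorphismProperty.of_isPullback (isPullback_left h) hr.surjective
  locallyOfFinitePresentation :=
    MorphismProperty.of_isPullback (isPullback_left h) hr.locallyOfFinitePresentation
  isPullback := isPullback_smul_of_isPullback h hr.isPullback hπ

lemma IsTorsor.epi {P T : Over S} [ModObj G P] {π : P ⟶ T} (hπ : IsTorsor G π) : Epi π := by
  have := hπ.flat
  have := hπ.surjective
  have : Epi π.left := Flat.epi_of_flat_of_surjective _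
  exact Over.epi_of_epi_left π

/-- Invariant morphisms on a torsor descend to the base. -/
lemma IsTorsor.exists_desc {P T X : Over S} [ModObj G P] {π : P ⟶ T} (hπ : IsTorsor G π)
    (g : P ⟶ X) (hg : γ[G, P] ≫ g = snd G P ≫ g) : ∃ k : T ⟶ X, π ≫ k = g := by
  have := hπ.flat
  have := hπ.surjective
  have := hπ.locallyOfFinitePresentation
  -- Two points of `P` over the same point of `T` differ by the action, so `g` agrees on them; `π`
  -- is an effective epimorphism.
  have h1 {Z : Scheme.{u}} (g₁ g₂ : Z ⟶ P.left) (h : g₁ ≫ π.left = g₂ ≫ π.left) :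
      g₁ ≫ g.left = g₂ ≫ g.left := by
    let f := (isPullback_left hπ.isPullback).lift g₁ g₂ h
    have h2 : f ≫ γ[G, P].left = g₁ := (isPullback_left hπ.isPullback).lift_fst _ _ _
    have h3 : f ≫ (snd G P).left = g₂ := (isPullback_left hπ.isPullback).lift_snd _ _ _
    rw [← h2, ← h3, Category.assoc, Category.assoc]
    exact congr(f ≫ ($hg).left)
  have h2 := EffectiveEpi.fac π.left g.left h1
  refine ⟨Over.homMk (EffectiveEpi.desc π.left g.left h1) ?_, Over.OverMorphism.ext h2⟩
  have : Epi π.left := inferInstance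
  rw [← cancel_epi π.left, reassoc_of% h2, Over.w, Over.w]

/-- An equivariant morphism of torsors is cartesian. -/
lemma IsTorsor.isPullback_of_isModHom {P W X T : Over S} [ModObj G P] [ModObj G W] {φ : P ⟶ W}
    {π : P ⟶ T} {r : W ⟶ X} {k : T ⟶ X} (hπ : IsTorsor G π) (hr : IsTorsor G r) [IsModHom G φ]
    (w : φ ≫ r = π ≫ k) : IsPullback φ π r k := by
  have hP' := IsPullback.of_hasPullback r k
  let ψ : P ⟶ pullback r k := pullback.lift φ π w
  have h2 : γ[G, P] ≫ φ = G ◁ φ ≫ γ[G, W] := IsModHom.smul_hom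
  -- The morphism `γ ≫ ψ` is a base change of `π`, hence an fppf cover. Pulling `ψ` back along it
  -- gives an identity (`hψ`), so `ψ` is an isomorphism by descent.
  have hκ : IsPullback (γ[G, P] ≫ ψ) (snd G P) (pullback.snd r k) π := by
    refine IsPullback.of_right ?_ ?_ hP'
    · have h1 := (isPullback_whiskerLeft_snd G φ).paste_horiz hr.isPullback
      rwa [Category.assoc, pullback.lift_fst, h2, ← w]
    · rw [Category.assoc, pullback.lift_snd, hπ.isPullback.w]
  have hψ : IsPullback γ[G, P] (𝟙 _) ψ (γ[G, P] ≫ ψ) := by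
    refine IsPullback.of_bot ?_ (by simp) hκ
    rw [pullback.lift_snd, Category.id_comp]
    exact hπ.isPullback
  have h3 : IsIso ψ.left := by
    refine MorphismProperty.of_isPullback_of_descendsAlong
      (P := MorphismProperty.isomorphisms Scheme.{u})
      (Q := @Surjective ⊓ @Flat ⊓ @LocallyOfFinitePresentation)
      (isPullback_left hψ).flip ⟨⟨?_, ?_⟩, ?_⟩ (inferInstance : IsIso (𝟙 _))
    · exact MorphismProperty.of_isPullback (isPullback_left hκ).flip hπ.surjective
    · exact MorphismProperty.of_isPullback (isPullback_left hκ).flip hπ.flat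
    · exact MorphismProperty.of_isPullback (isPullback_left hκ).flip hπ.locallyOfFinitePresentation
  have : IsIso ψ := (Over.isoMk (asIso ψ.left) (Over.w ψ)).isIso_hom
  exact .of_iso hP' (asIso ψ).symm (.refl _) (.refl _) (.refl _)
    (by simpa using! pullback.lift_fst φ π w) (by simpa using! pullback.lift_snd φ π w)
    (by simp) (by simp)

end Torsors

/-! ### The quotient stack of a torsor is its base -/

section QuotientStack

variable {S : Scheme.{u}} {G : Over S} [GrpObj G] {W X : Over S} [ModObj G W] {r : W ⟶ X}
  (hr : IsTorsor G r)

namespace QuotientStack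

lemma smul_φ (ξ : QuotientStack G W) : γ[G, ξ.total] ≫ ξ.φ = G ◁ ξ.φ ≫ γ[G, W] :=
  have := ξ.equivariant
  IsModHom.smul_hom

include hr in
lemma exists_classify (ξ : QuotientStack G W) : ∃ k : ξ.base ⟶ X, ξ.π ≫ k = ξ.φ ≫ r := by
  refine ξ.isTorsor.exists_desc (ξ.φ ≫ r) ?_
  rw [← Category.assoc, smul_φ, Category.assoc, hr.isPullback.w, whiskerLeft_snd_assoc]

/-- The morphism to `X` corresponding to an object of the quotient stack. -/
noncomputable def classify (ξ : QuotientStack G W) : ξ.base ⟶ X := (exists_classify hr ξ).choose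

lemma π_classify (ξ : QuotientStack G W) : ξ.π ≫ classify hr ξ = ξ.φ ≫ r :=
  (exists_classify hr ξ).choose_spec

lemma isPullback_classify (ξ : QuotientStack G W) : IsPullback ξ.φ ξ.π r (classify hr ξ) :=
  have := ξ.equivariant
  ξ.isTorsor.isPullback_of_isModHom hr (π_classify hr ξ).symm

/-- The functor from the quotient stack to the points of `X`. -/
noncomputable def toOver : QuotientStack G W ⥤ Over X where
  obj ξ := Over.mk (classify hr ξ)
  map {ξ ζ} f := Over.homMk (Hom.base f) (by
    have := ξ.isTorsor.epi
    have h1 : Hom.total f ≫ ζ.π = ξ.π ≫ Hom.base f := (Hom.isPullback f).w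
    rw [← cancel_epi ξ.π]
    change ξ.π ≫ Hom.base f ≫ classify hr ζ = ξ.π ≫ classify hr ξ
    rw [← reassoc_of% h1, π_classify, π_classify, ← Category.assoc, Hom.comp_φ f])
  map_id ξ := rfl
  map_comp f g := rfl

instance : (toOver hr).Faithful where
  map_injective {ξ ζ f g} h := by
    have h1 : Hom.base f = Hom.base g := congr(($h).left)
    refine Hom.ext h1 ?_
    apply (isPullback_classify hr ζ).hom_ext
    · rw [Hom.comp_φ f, Hom.comp_φ g]
    · rw [(Hom.isPullback f).w, (Hom.isPullback g).w, h1]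

/-- `ζ.total` is the pullback of `W` along the classifying morphism, so the map of total spaces is
forced by its components in `W` and `ζ.base`. -/
lemma exists_hom {ξ ζ : QuotientStack G W} (b : ξ.base ⟶ ζ.base)
    (hb : b ≫ classify hr ζ = classify hr ξ) : ∃ f : Hom ξ ζ, f.base = b := by
  have hζ := isPullback_classify hr ζ
  let t : ξ.total ⟶ ζ.total := hζ.lift ξ.φ (ξ.π ≫ b) (by rw [Category.assoc, hb, π_classify])
  have h1 : t ≫ ζ.φ = ξ.φ := hζ.lift_fst _ _ _
  have h2 : t ≫ ζ.π = ξ.π ≫ b := hζ.lift_snd _ _ _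
  refine ⟨⟨b, t, ⟨?_⟩, ?_, h1⟩, rfl⟩
  · change γ[G, ξ.total] ≫ t = G ◁ t ≫ γ[G, ζ.total]
    apply hζ.hom_ext
    · rw [Category.assoc, h1, smul_φ, Category.assoc, smul_φ, ← whiskerLeft_comp_assoc, h1]
    · rw [Category.assoc, Category.assoc, h2, ζ.isTorsor.isPullback.w, whiskerLeft_snd_assoc, h2,
        ← Category.assoc, ξ.isTorsor.isPullback.w, Category.assoc]
  · refine IsPullback.of_right ?_ h2 hζ
    rw [h1, hb]
    exact isPullback_classify hr ξ

instance : (toOver hr).Full where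
  map_surjective {ξ ζ} b := by
    obtain ⟨f, hf⟩ := exists_hom hr (ξ := ξ) (ζ := ζ) b.left (Over.w b)
    exact ⟨f, Over.OverMorphism.ext hf⟩

instance : (toOver hr).EssSurj where
  mem_essImage T := by
    have hP := IsPullback.of_hasPullback r T.hom
    let := pullbackAction hP hr.isPullback.w
    have := pullbackAction_isModHom hP hr.isPullback.w
    let ξ : QuotientStack G W :=
      { base := T.left
        total := pullback r T.hom
        π := pullback.snd r T.hom
        isTorsor := hr.of_isPullback hP (pullbackAction_comp hP hr.isPullback.w)
        φ := pullback.fst r T.hom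
        equivariant := this }
    have h1 : classify hr ξ = T.hom := by
      have := ξ.isTorsor.epi
      rw [← cancel_epi ξ.π, π_classify]
      exact hP.w
    exact ⟨ξ, ⟨Over.isoMk (Iso.refl T.left) ((Category.id_comp T.hom).trans h1.symm)⟩⟩

include hr in
/-- If `W` is a `G`-torsor over `X`, then `[W/G]` is represented by `X`. -/
theorem isRepresentedBy_of_isTorsor {B : Over S} {q : W ⟶ B} {f : X ⟶ B} (h : r ≫ f = q) :
    IsRepresentedBy (G := G) q f := by
  refine ⟨toOver hr, NatIso.ofComponents (fun ξ ↦ Iso.refl _) ?_, { }, fun ξ ↦ ?_⟩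
  · intro ξ ζ f
    exact (Category.comp_id _).trans (Category.id_comp _).symm
  · change ξ.π ≫ 𝟙 _ ≫ classify hr ξ ≫ f = _
    rw [Category.id_comp, ← Category.assoc, π_classify, Category.assoc, h]

end QuotientStack

end QuotientStack

/-! ### Descent of geometric integrality -/

section GeometricallyIntegral

lemma isIntegral_of_flat_of_surjective {X Y : Scheme.{u}} (f : X ⟶ Y) [Flat f] [Surjective f]
    [IsIntegral X] : IsIntegral Y := by
  rw [isIntegral_iff_irreducibleSpace_and_isReduced]
  refine ⟨f.surjective.irreducibleSpace f.continuous, ?_⟩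
  -- A flat local homomorphism is faithfully flat, hence injective, so stalks of `Y` embed in
  -- reduced rings.
  have (y : Y) : _root_.IsReduced (Y.presheaf.stalk y) := by
    obtain ⟨x, rfl⟩ := f.surjective y
    have : Function.Injective (f.stalkMap x).hom := by
      algebraize [(f.stalkMap x).hom]
      have : Module.FaithfullyFlat (Y.presheaf.stalk (f x)) (X.presheaf.stalk x) :=
        @Module.FaithfullyFlat.of_flat_of_isLocalHom _ _ _ _ _ _ _
          (Flat.stalkMap f x) (f.toLRSHom.prop x)
      exact ‹RingHom.FaithfullyFlat _›.injective
    exact isReduced_of_injective (f.stalkMap x).hom this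
  exact isReduced_of_isReduced_stalk Y

lemma geometricallyIntegral_of_isPullback {W X Z B : Scheme.{u}} {z : W ⟶ Z} {r : W ⟶ X}
    {p : Z ⟶ B} {f : X ⟶ B} (h : IsPullback z r p f) [Surjective p] [GeometricallyIntegral z] :
    GeometricallyIntegral f := by
  refine ⟨fun K _ y A fst snd hA ↦ ?_⟩
  have hT := IsPullback.of_hasPullback p y
  have : Surjective (pullback.snd p y) := MorphismProperty.of_isPullback hT ‹Surjective p›
  -- A `K`-point of `B` need not lift to `Z`. It lifts over the residue field of a point of the
  -- fibre of `p`; there the fibre of `f` becomes a fibre of `z`, and integrality descends along the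
  -- field extension.
  let t : ↥(pullback p y) := ((pullback.snd p y).surjective (default : Spec (.of K))).choose
  let L : Scheme.{u} := Spec ((pullback p y).residueField t)
  let m : L ⟶ Spec (.of K) := (pullback p y).fromSpecResidueField t ≫ pullback.snd p y
  let l : L ⟶ Z := (pullback p y).fromSpecResidueField t ≫ pullback.fst p y
  have hlm : l ≫ p = m ≫ y := by
    simp only [l, m, Category.assoc, pullback.condition]
  have hA' := IsPullback.of_hasPullback snd m
  have h1 : IsPullback (pullback.fst snd m ≫ fst) (pullback.snd snd m) f (l ≫ p) := by
    rw [hlm]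
    exact (hA'.flip.paste_vert hA.flip).flip
  let g := h.lift (pullback.snd snd m ≫ l) (pullback.fst snd m ≫ fst) (by
    rw [Category.assoc, ← h1.w])
  have h2 : IsPullback g (pullback.snd snd m) z l := by
    refine IsPullback.of_right ?_ (h.lift_fst _ _ _) h.flip
    rwa [h.lift_snd]
  have h3 : IsIntegral (pullback snd m) :=
    GeometricallyIntegral.geometrically_isIntegral (f := z) l _ _ h2
  have h4 : Flat m := inferInstance
  have h5 : Surjective m := ⟨fun x ↦ ⟨default, Subsingleton.elim _ _⟩⟩
  have h6 : Flat (pullback.fst snd m) := MorphismProperty.of_isPullback hA'.flip h4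
  have h7 : Surjective (pullback.fst snd m) := MorphismProperty.of_isPullback hA'.flip h5
  exact isIntegral_of_flat_of_surjective (pullback.fst snd m)

end GeometricallyIntegral

/-! ### The contracted product as a scheme -/

section ContractedProduct

variable {S : Scheme.{u}}

lemma isPullback_of_left {A X Y Z : Over S} {fst : A ⟶ X} {snd : A ⟶ Y} {f : X ⟶ Z} {g : Y ⟶ Z}
    (h : IsPullback fst.left snd.left f.left g.left) : IsPullback fst snd f g := by
  refine ⟨⟨Over.OverMorphism.ext h.w⟩, ⟨PullbackCone.IsLimit.mk _
    (fun s ↦ Over.homMk (h.lift s.fst.left s.snd.left congr(($s.condition).left)) ?_)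
    (fun s ↦ ?_) (fun s ↦ ?_) (fun s m h1 h2 ↦ ?_)⟩⟩
  · rw [← Over.w fst, ← Category.assoc, h.lift_fst, Over.w]
  · exact Over.OverMorphism.ext (h.lift_fst _ _ _)
  · exact Over.OverMorphism.ext (h.lift_snd _ _ _)
  · apply Over.OverMorphism.ext
    apply h.hom_ext
    · exact congr(($h1).left).trans (h.lift_fst _ _ _).symm
    · exact congr(($h2).left).trans (h.lift_snd _ _ _).symm

lemma isPullback_fst_left_snd_left (A B : Over S) :
    IsPullback (fst A B).left (snd A B).left A.hom B.hom :=
  IsPullback.of_hasPullback A.hom B.hom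

variable {G : Over S} [GrpObj G]

/-- A torsor under an affine group scheme is affine. -/
lemma IsTorsor.isAffineHom [IsAffineHom G.hom] {Z B : Over S} [ModObj G Z] {p : Z ⟶ B}
    (hp : IsTorsor G p) : IsAffineHom p.left := by
  have := hp.flat
  have := hp.surjective
  have := hp.locallyOfFinitePresentation
  have : IsAffineHom (snd G Z).left :=
    MorphismProperty.of_isPullback (isPullback_fst_left_snd_left G Z) ‹IsAffineHom G.hom›
  exact isAffineHom_of_isPullback (isPullback_left hp.isPullback).flip

variable {Z Y B : Over S} [ModObj G Y] [ModObj G Z] {p : Z ⟶ B}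

lemma smul_fst : γ[G, Z ⊗ Y] ≫ fst Z Y = G ◁ fst Z Y ≫ γ[G, Z] := lift_fst _ _

lemma isPullback_smul_fst (hp : IsTorsor G p) :
    IsPullback (γ[G, Z ⊗ Y] ≫ fst Z Y) (snd G (Z ⊗ Y)) p (fst Z Y ≫ p) := by
  rw [smul_fst]
  exact (isPullback_whiskerLeft_snd G (fst Z Y)).paste_horiz hp.isPullback

lemma isPullback_smul_smul_fst (hp : IsTorsor G p) :
    IsPullback (G ◁ γ[G, Z ⊗ Y] ≫ γ[G, Z ⊗ Y] ≫ fst Z Y) (snd G (G ⊗ Z ⊗ Y)) p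
      (snd G (Z ⊗ Y) ≫ fst Z Y ≫ p) := by
  rw [← (isPullback_smul_fst hp).w, smul_fst, ← whiskerLeft_comp_assoc, smul_fst]
  exact (isPullback_whiskerLeft_snd G (G ◁ fst Z Y ≫ γ[G, Z])).paste_horiz hp.isPullback

/-- The contracted product is a scheme, over which `Z ⊗ Y` is a torsor. -/
lemma exists_isTorsor_isPullback [IsAffineHom G.hom] [IsQuasiAffineHom Y.hom] (hp : IsTorsor G p) :
    ∃ (X : Over S) (f : X ⟶ B) (r : Z ⊗ Y ⟶ X), IsTorsor G r ∧ IsPullback (fst Z Y) r p f ∧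
      IsQuasiAffineHom f.left := by
  have := hp.isAffineHom
  have := hp.flat
  have := hp.surjective
  have := hp.locallyOfFinitePresentation
  have : IsQuasiAffineHom (fst Z Y).left :=
    isQuasiAffineHom_of_isPullback (isPullback_fst_left_snd_left Z Y)
  have := isSeparated_of_isQuasiAffineHom (fst Z Y).left
  have := quasiCompact_of_isQuasiAffineHom (fst Z Y).left
  have : IsAffineHom (snd G (Z ⊗ Y)).left :=
    MorphismProperty.of_isPullback (isPullback_fst_left_snd_left G (Z ⊗ Y)) ‹IsAffineHom G.hom›
  have h : γ[G, Z ⊗ Y] ≫ fst Z Y ≫ p = snd G (Z ⊗ Y) ≫ fst Z Y ≫ p := by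
    rw [← (isPullback_smul_fst hp).w, Category.assoc]
  have he : ((λ_ (Z ⊗ Y)).inv ≫ η[G] ▷ (Z ⊗ Y)) ≫ γ[G, Z ⊗ Y] = 𝟙 _ := by
    rw [Category.assoc, ModObj.one_smul_self, Iso.inv_hom_id]
  have hva : G ◁ γ[G, Z ⊗ Y] ≫ γ[G, Z ⊗ Y] =
      ((α_ G G (Z ⊗ Y)).inv ≫ μ[G] ▷ (Z ⊗ Y)) ≫ γ[G, Z ⊗ Y] := by
    rw [Category.assoc, ModObj.mul_smul_self, Iso.inv_hom_id_assoc]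
  have hvs : G ◁ γ[G, Z ⊗ Y] ≫ snd G (Z ⊗ Y) = snd G (G ⊗ Z ⊗ Y) ≫ γ[G, Z ⊗ Y] :=
    whiskerLeft_snd _ _
  have hds : ((α_ G G (Z ⊗ Y)).inv ≫ μ[G] ▷ (Z ⊗ Y)) ≫ snd G (Z ⊗ Y) =
      snd G (G ⊗ Z ⊗ Y) ≫ snd G (Z ⊗ Y) := by
    rw [Category.assoc, whiskerRight_snd, associator_inv_snd]
  obtain ⟨X, f, r, hX, har, hf⟩ := exists_isPullback_isQuasiAffineHom (p := p.left)
    (z := (fst Z Y).left) (q := (fst Z Y).left ≫ p.left)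
    (a := γ[G, Z ⊗ Y].left) (s := (snd G (Z ⊗ Y)).left) rfl congr(($h).left)
    (isPullback_left (isPullback_smul_fst hp)) (isPullback_left (isPullback_smul_smul_fst hp))
    congr(($he).left) congr(($hva).left) congr(($hvs).left) congr(($hds).left)
  let f' : Over.mk (f ≫ B.hom) ⟶ B := Over.homMk f rfl
  let r' : Z ⊗ Y ⟶ Over.mk (f ≫ B.hom) := Over.homMk r (by
    change r ≫ f ≫ B.hom = _
    rw [← reassoc_of% hX.w, Over.w, Over.w])
  have hX' : IsPullback (fst Z Y) r' p f' := isPullback_of_left hX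
  refine ⟨Over.mk (f ≫ B.hom), f', r', ⟨?_, ?_, ?_, ?_⟩, hX', hf⟩
  · exact MorphismProperty.of_isPullback hX ‹Flat p.left›
  · exact MorphismProperty.of_isPullback hX ‹Surjective p.left›
  · exact MorphismProperty.of_isPullback hX ‹LocallyOfFinitePresentation p.left›
  -- Since `W = Z ×_B X`, the product `W ×_X W` is `Z ×_B W`, which is `G × W`.
  · refine IsPullback.of_right ?_ (Over.OverMorphism.ext har) hX'
    rw [← hX'.w]
    exact isPullback_smul_fst hp

end ContractedProduct

end ContractedProducts

open ContractedProducts in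
theorem mainTheorem8 (S : Scheme.{u}) (G Y Z B : Over S)
    [GrpObj G] [Smooth G.hom] [IsAffineHom G.hom]
    [ModObj G Y] [IsQuasiAffineHom Y.hom]
    [ModObj G Z] (p : Z ⟶ B) (hp : IsTorsor G p) :
    ∃ (X : Over S) (f : X ⟶ B),
      ContractedProductIsRepresentedBy G p Y f ∧
      IsQuasiAffineHom f.left ∧
      (IsSeparated Y.hom → IsSeparated f.left) ∧
      (Smooth Y.hom → Smooth f.left) ∧
      (IsFiniteType Y.hom → IsFiniteType f.left) ∧
      (GeometricallyIntegral Y.hom → GeometricallyIntegral f.left) := by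
  obtain ⟨X, f, r, hr, hX, hf⟩ := exists_isTorsor_isPullback (Y := Y) hp
  have := hp.isAffineHom
  have hX' := isPullback_left hX
  have hY := isPullback_fst_left_snd_left Z Y
  -- A torsor under an affine group is affine over its base, so `p` is quasi-compact and fpqc
  -- descent applies.
  have hp' : (@Surjective ⊓ @Flat ⊓ @QuasiCompact : MorphismProperty Scheme.{u}) p.left :=
    ⟨⟨hp.surjective, hp.flat⟩, inferInstance⟩
  refine ⟨X, f, QuotientStack.isRepresentedBy_of_isTorsor hr hX.w.symm, hf,
    fun _ ↦ isSeparated_of_isQuasiAffineHom f.left, fun h ↦ ?_, fun h ↦ ?_, fun h ↦ ?_⟩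
  · exact MorphismProperty.of_isPullback_of_descendsAlong hX' hp'
      (MorphismProperty.of_isPullback hY.flip h)
  · have h1 : LocallyOfFiniteType (fst Z Y).left :=
      MorphismProperty.of_isPullback hY.flip h.toLocallyOfFiniteType
    have h2 : LocallyOfFiniteType f.left :=
      MorphismProperty.of_isPullback_of_descendsAlong hX' hp' h1
    have h3 : QuasiCompact f.left := quasiCompact_of_isQuasiAffineHom f.left
    exact { }
  · have := hp.surjective
    have : GeometricallyIntegral (fst Z Y).left := MorphismProperty.of_isPullback hY.flip h
    exact geometricallyIntegral_of_isPullback hX'
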